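/- **Theorem 5.1 (Local bifurcation).** Let $r>1$ and $\alpha\in(1,2)$. Let $\mathbb T=\mathbb R/2\pi\mathbb Z$, let $\hat f(k)=\frac1{2\pi}\int_{-\pi}^{\pi}f(x)e^{-ikx}\,dx$, and let $L_r f=\sum_{k\ne0}|k|^{-r}\hat f(k)e^{ik(\cdot)}$. Let $C^\alpha_{0,\mathrm{even}}(\mathbb T)$ be the Banach space, with its usual Hölder norm, of real-valued, even, zero-mean functions in $C^{1,\alpha-1}(\mathbb T)$, let $\mathbb R_+$ be the set of nonnegative real numbers, and let $$F(\phi,\mu)=\mu\phi-L_r\phi-\tfrac12\phi^2+\tfrac12\widehat{\phi^2}(0),\qquad (\phi,\mu)\in C^\alpha_{0,\mathrm{even}}(\mathbb T)\times\mathbb R_+ .$$ Then $F(0,\mu)=0$ for all $\mu$. A solution of $F(\phi,\mu)=0$ is called nontrivial if $\phi\neq0$. For each integer $k\ge1$, put $\mu_k^*=k^{-r}$. The point $(0,\mu_k^*)$ is a bifurcation point: each of its neighbourhoods contains a nontrivial solution of $F(\phi,\mu)=0$. More precisely, there exist $\varepsilon_0>0$ and a (real-)analytic map $$(-\varepsilon_0,\varepsilon_0)\ni\varepsilon\mapsto(\phi_k(\varepsilon),\mu_k(\varepsilon))\in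 C^\alpha_{0,\mathrm{even}}(\mathbb T)\times\mathbb R_+$$ such that 1. $\phi_k(0)=0$, $\mu_k(0)=\mu_k^*$ and $D_\varepsilon\phi_k(0)=\cos(k\,\cdot)$; 2. for every $|\varepsilon|<\varepsilon_0$, $F(\phi_k(\varepsilon),\mu_k(\varepsilon))=0$, $\mu_k(\varepsilon)>0$ and the even function $\phi_k(\varepsilon)$ is $\frac{2\pi}{k}$-periodic, and $\phi_k(\varepsilon)\ne0$ if $\varepsilon\ne0$; 3. there is a neighbourhood of $(0,\mu_k^*)$ in $C^\alpha_{0,\mathrm{even}}(\mathbb T)\times\mathbb R_+$ in which every nontrivial solution of $F(\phi,\mu)=0$ is of the form $(\phi_k(\varepsilon),\mu_k(\varepsilon))$ with $|\varepsilon|<\varepsilon_0$. -/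

import Mathlib

open Filter Topology
open scoped NNReal

/-- The real vector space of real-valued functions of class `C^{1, α - 1}` on the torus
(for `1 < α < 2` this is the Hölder space `C^α`), with zero mean and even. Functions on the torus
are functions on `ℝ` of period `2π`. Note that a differentiable function whose derivative is Hölder
continuous is continuously differentiable. -/
def holderZeroEvenSubmodule (α : ℝ) : Submodule ℝ (ℝ → ℝ) where
  carrier := {f | Function.Periodic f (2 * Real.pi) ∧ Differentiable ℝ f ∧
    MemHolder (α - 1).toNNReal (deriv f) ∧ (∫ x in (-Real.pi)..Real.pi, f x) = 0 ∧ Function.Even f}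
  zero_mem' := by
    refine ⟨fun x => rfl, differentiable_const 0, ?_, by simp, fun x => rfl⟩
    have : deriv (0 : ℝ → ℝ) = fun _ => 0 := by
      ext x
      exact deriv_const x (0 : ℝ)
    rw [this]
    exact memHolder_const'
  add_mem' := by
    rintro f g ⟨hf1, hf2, hf3, hf4, hf5⟩ ⟨hg1, hg2, hg3, hg4, hg5⟩
    refine ⟨hf1.add hg1, hf2.add hg2, ?_, ?_, hf5.add hg5⟩
    · have : deriv (f + g) = deriv f + deriv g := by
        ext x
        exact deriv_add (hf2 x) (hg2 x)
      rw [this]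
      exact hf3.add hg3
    · have := intervalIntegral.integral_add (hf2.continuous.intervalIntegrable (-Real.pi) Real.pi)
        (hg2.continuous.intervalIntegrable (-Real.pi) Real.pi) (μ := MeasureTheory.volume)
      simpa [hf4, hg4] using this
  smul_mem' := by
    rintro c f ⟨hf1, hf2, hf3, hf4, hf5⟩
    refine ⟨hf1.smul c, hf2.const_smul c, ?_, ?_, hf5.const_smul c⟩
    · have : deriv (c • f) = c • deriv f := by
        ext x
        exact deriv_const_smul c (hf2 x)
      rw [this]
      exact hf3.smul
    · simp [hf4]

/-- The space `C^α_{0,even}(𝕋)` for `1 < α < 2`: even, zero-mean, real-valued functions of class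
`C^{1, α - 1}` on the torus. It is a type synonym of the submodule above, so that its topology is
the one of the Hölder norm and not that of pointwise convergence. -/
def HolderZeroEven (α : ℝ) : Type := holderZeroEvenSubmodule α

namespace HolderZeroEven

variable {α : ℝ}

instance : AddCommGroup (HolderZeroEven α) :=
  inferInstanceAs (AddCommGroup (holderZeroEvenSubmodule α))

instance : Module ℝ (HolderZeroEven α) :=
  inferInstanceAs (Module ℝ (holderZeroEvenSubmodule α))

/-- The function underlying an element of `C^α_{0,even}(𝕋)`. -/
def toFun (f : HolderZeroEven α) : ℝ → ℝ := Subtype.val (p := (· ∈ holderZeroEvenSubmodule α)) f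

instance : CoeFun (HolderZeroEven α) (fun _ => ℝ → ℝ) := ⟨toFun⟩

theorem coe_zero : ⇑(0 : HolderZeroEven α) = (0 : ℝ → ℝ) := rfl

theorem coe_add (f g : HolderZeroEven α) : ⇑(f + g) = ⇑f + ⇑g := rfl

theorem coe_smul (c : ℝ) (f : HolderZeroEven α) : ⇑(c • f) = c • ⇑f := rfl

theorem ext' {f g : HolderZeroEven α} (h : ⇑f = ⇑g) : f = g := Subtype.ext h

theorem periodic (f : HolderZeroEven α) : Function.Periodic f (2 * Real.pi) := f.2.1

theorem differentiable (f : HolderZeroEven α) : Differentiable ℝ f := f.2.2.1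

theorem memHolder_deriv (f : HolderZeroEven α) : MemHolder (α - 1).toNNReal (deriv f) := f.2.2.2.1

theorem integral_eq_zero (f : HolderZeroEven α) : (∫ x in (-Real.pi)..Real.pi, f x) = 0 :=
  f.2.2.2.2.1

theorem even (f : HolderZeroEven α) : Function.Even f := f.2.2.2.2.2

theorem deriv_coe_add (f g : HolderZeroEven α) : deriv ⇑(f + g) = deriv ⇑f + deriv ⇑g := by
  ext x
  exact deriv_add (f.differentiable x) (g.differentiable x)

theorem deriv_coe_smul (c : ℝ) (f : HolderZeroEven α) : deriv ⇑(c • f) = c • deriv ⇑f := by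
  ext x
  exact deriv_const_smul c (f.differentiable x)

theorem deriv_periodic (f : HolderZeroEven α) : Function.Periodic (deriv f) (2 * Real.pi) := by
  intro x
  rw [← deriv_comp_add_const]
  congr 1
  ext y
  exact f.periodic y

theorem bddAbove_abs (f : HolderZeroEven α) : BddAbove (Set.range fun x => |f x|) := by
  have h := f.periodic.isBounded_of_continuous (by positivity) f.differentiable.continuous
  obtain ⟨C, hC⟩ := h.exists_norm_le
  refine ⟨C, ?_⟩
  rintro _ ⟨x, rfl⟩
  exact hC _ ⟨x, rfl⟩

theorem bddAbove_abs_deriv (f : HolderZeroEven α) :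
    BddAbove (Set.range fun x => |deriv f x|) := by
  obtain ⟨C, hC⟩ := f.memHolder_deriv
  have hp : (0 : ℝ) < 2 * Real.pi := by positivity
  refine ⟨|deriv f 0| + C * (2 * Real.pi) ^ ((α - 1).toNNReal : ℝ), ?_⟩
  rintro _ ⟨x, rfl⟩
  obtain ⟨y, hy, hxy⟩ := f.deriv_periodic.exists_mem_Ico₀ hp x
  have h1 : dist (deriv f y) (deriv f 0) ≤ C * (2 * Real.pi) ^ ((α - 1).toNNReal : ℝ) := by
    refine hC.dist_le_of_le ?_
    rw [Real.dist_eq, sub_zero, abs_of_nonneg hy.1]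
    exact hy.2.le
  simp only [hxy]
  rw [Real.dist_eq] at h1
  have h2 : |deriv f y| ≤ |deriv f 0| + |deriv f y - deriv f 0| := by
    have := abs_add_le (deriv f 0) (deriv f y - deriv f 0)
    simpa using this
  linarith

/-- The standard norm of `C^{1, α - 1}`: the sup norms of the function and of its derivative, plus
the Hölder seminorm of exponent `α - 1` of the derivative. -/
noncomputable instance : Norm (HolderZeroEven α) where
  norm f := (⨆ x, |f x|) + (⨆ x, |deriv f x|) + (nnHolderNorm (α - 1).toNNReal (deriv f) : ℝ)

theorem norm_def (f : HolderZeroEven α) :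
    ‖f‖ = (⨆ x, |f x|) + (⨆ x, |deriv f x|) + (nnHolderNorm (α - 1).toNNReal (deriv f) : ℝ) := rfl

theorem normCore : NormedSpace.Core ℝ (HolderZeroEven α) where
  norm_nonneg f := by
    rw [norm_def]
    have h1 : 0 ≤ ⨆ x, |f x| := Real.iSup_nonneg fun x => abs_nonneg _
    have h2 : 0 ≤ ⨆ x, |deriv f x| := Real.iSup_nonneg fun x => abs_nonneg _
    positivity
  norm_smul c f := by
    rw [norm_def, norm_def, deriv_coe_smul, coe_smul, f.memHolder_deriv.nnHolderNorm_smul]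
    simp only [Pi.smul_apply, smul_eq_mul, abs_mul, NNReal.coe_mul, coe_nnnorm, Real.norm_eq_abs]
    rw [← Real.mul_iSup_of_nonneg (abs_nonneg c), ← Real.mul_iSup_of_nonneg (abs_nonneg c)]
    ring
  norm_triangle f g := by
    have h1 : (⨆ x, |(f + g) x|) ≤ (⨆ x, |f x|) + ⨆ x, |g x| :=
      ciSup_le fun x => (abs_add_le (f x) (g x)).trans
        (add_le_add (le_ciSup f.bddAbove_abs x) (le_ciSup g.bddAbove_abs x))
    have h2 : (⨆ x, |deriv (f + g) x|) ≤ (⨆ x, |deriv f x|) + ⨆ x, |deriv g x| := by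
      rw [deriv_coe_add]
      exact ciSup_le fun x => (abs_add_le (deriv f x) (deriv g x)).trans
        (add_le_add (le_ciSup f.bddAbove_abs_deriv x) (le_ciSup g.bddAbove_abs_deriv x))
    have h3 : (nnHolderNorm (α - 1).toNNReal (deriv ⇑(f + g)) : ℝ) ≤
        nnHolderNorm (α - 1).toNNReal (deriv f) + nnHolderNorm (α - 1).toNNReal (deriv g) := by
      rw [deriv_coe_add]
      exact_mod_cast f.memHolder_deriv.nnHolderNorm_add_le g.memHolder_deriv
    rw [norm_def, norm_def, norm_def]
    linarith
  norm_eq_zero_iff f := by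
    constructor
    · intro h
      rw [norm_def] at h
      have h1 : 0 ≤ ⨆ x, |f x| := Real.iSup_nonneg fun x => abs_nonneg _
      have h2 : 0 ≤ ⨆ x, |deriv f x| := Real.iSup_nonneg fun x => abs_nonneg _
      have h3 : (0 : ℝ) ≤ nnHolderNorm (α - 1).toNNReal (deriv f) := NNReal.coe_nonneg _
      have h4 : (⨆ x, |f x|) = 0 := by linarith
      refine ext' (funext fun x => ?_)
      have h5 := le_ciSup f.bddAbove_abs x
      rw [h4] at h5
      exact abs_nonpos_iff.1 h5
    · rintro rfl
      have : deriv (0 : ℝ → ℝ) = 0 := by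
        ext x
        exact deriv_const x (0 : ℝ)
      rw [norm_def, coe_zero, this]
      simp

noncomputable instance : NormedAddCommGroup (HolderZeroEven α) :=
  NormedAddCommGroup.ofCore normCore

noncomputable instance : NormedSpace ℝ (HolderZeroEven α) :=
  NormedSpace.ofCore normCore

end HolderZeroEven

/-- The Fourier coefficient `(1 / 2π) ∫_{-π}^{π} f(x) e^{-ikx} dx` of a function on the torus. -/
noncomputable def torusFourierCoeff (f : ℝ → ℂ) (k : ℤ) : ℂ :=
  (1 / (2 * Real.pi) : ℂ) *
    ∫ x in (-Real.pi)..Real.pi, f x * Complex.exp (-(Complex.I * k * x))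

/-- The Fourier multiplier `L_r` with symbol `|k|^{-r}` for `k ≠ 0` and `0` for `k = 0`. For
`r > 1` and integrable `f` the series converges absolutely. -/
noncomputable def fourierMultiplierL (r : ℝ) (f : ℝ → ℂ) (x : ℝ) : ℂ :=
  ∑' k : ℤ, (if k = 0 then 0 else ((|(k : ℝ)| ^ (-r) : ℝ) : ℂ)) * torusFourierCoeff f k *
    Complex.exp (Complex.I * k * x)

/-- The function `F(φ, μ) = μ φ - L_r φ - φ² / 2 + (mean of φ²) / 2` on the torus, the mean of `φ²`
being its zeroth Fourier coefficient. The steady equation with wave speed `μ` is `F(φ, μ) = 0`. -/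
noncomputable def steadyF (r : ℝ) {α : ℝ} (φ : HolderZeroEven α) (μ : ℝ) : ℝ → ℂ := fun x =>
  (μ : ℂ) * φ x - fourierMultiplierL r (fun y => (φ y : ℂ)) x - (φ x : ℂ) ^ 2 / 2 +
    torusFourierCoeff (fun y => (φ y : ℂ) ^ 2) 0 / 2

/-- `(0, μ₀)` is a bifurcation point of the equation `G(φ, μ) = 0`: all the points `(0, μ)` are
(trivial) solutions, and every neighbourhood of `(0, μ₀)` contains a solution `(φ, μ)` with
`φ ≠ 0`. -/
def IsBifurcationPoint {X Y : Type*} [TopologicalSpace X] [Zero X] [Zero Y] (G : X → ℝ → Y)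
    (μ₀ : ℝ) : Prop :=
  (∀ μ : ℝ, G 0 μ = 0) ∧ ∃ᶠ p : X × ℝ in 𝓝 (0, μ₀), G p.1 p.2 = 0 ∧ p.1 ≠ 0

/-! The equation has the form μu - Lu - B(u,u) = 0, where L is linear and B(u,u) is half of u² minus
its mean. Both are bounded on the Hölder space, and L is diagonal on the cosines. Its eigenvalues
n^{-r} are distinct, so μ₀ = k^{-r} is simple with eigenvector c = cos(kx), and bifurcation from a
simple eigenvalue (Crandall-Rabinowitz) applies.

Let a be the coordinate along c. Put u = ε(c + v) with a(v) = 0 and μ = μ₀ + s, divide by ε, and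
store both unknowns in w = v + s c, so that s = a(w). At ε = 0 the derivative in w at the origin is
T = μ₀ - L + a(·)c, and where T is invertible the analytic implicit function theorem gives w(ε)
(`exists_reduced_branch`). That theorem only sees small v, so uniqueness for the original equation
also needs v to be small at every small nontrivial solution; this is an a priori bound in
`exists_analytic_branch`. Periodicity follows by solving again inside the closed subspace of
2π/k-periodic functions and using uniqueness (`exists_analytic_branch_mem`).

For the concrete operators, a multiplier with absolutely summable symbol is convolution with a
continuous kernel, hence bounded on the Hölder space without any regularity theory. T is μ₀ minus
the multiplier with symbol n^{-r} - δ_{nk}, which never equals μ₀, and T⁻¹ is again a scalar plus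
such a multiplier (`scalarSubMultiplier`). -/

/-! ### Bifurcation from a simple eigenvalue for quadratic equations in a Banach space. -/

section AbstractBifurcation

open scoped ContDiff

variable {E : Type*} [NormedAddCommGroup E] [NormedSpace ℝ E]

/-- The quadratic equation `μ u - L u - B u u` for `u = ε (c + v)` and `μ = μ₀ + a w`, divided by
`ε`, where `v = w - a w • c`. -/
noncomputable def reducedMap (L : E →L[ℝ] E) (B : E →L[ℝ] E →L[ℝ] E) (a : E →L[ℝ] ℝ) (c : E) (μ₀ : ℝ)
    (p : ℝ × E) : E :=
  (μ₀ + a p.2) • (c + p.2 - a p.2 • c) - L (c + p.2 - a p.2 • c) -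
    p.1 • B (c + p.2 - a p.2 • c) (c + p.2 - a p.2 • c)

variable {L : E →L[ℝ] E} {B : E →L[ℝ] E →L[ℝ] E} {a : E →L[ℝ] ℝ} {c : E} {μ₀ : ℝ}

theorem contDiff_reducedMap : ContDiff ℝ ω (reducedMap L B a c μ₀) := by
  unfold reducedMap
  have hu : ContDiff ℝ ω fun p : ℝ × E => c + p.2 - a p.2 • c := by fun_prop
  have hB : ContDiff ℝ ω fun p : ℝ × E =>
      B (c + p.2 - a p.2 • c) (c + p.2 - a p.2 • c) :=
    (B.contDiff.comp hu).clm_apply hu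
  exact (((contDiff_const.add (a.contDiff.comp contDiff_snd)).smul hu).sub
    (L.contDiff.comp hu)).sub (contDiff_fst.smul hB)

theorem fderiv_reducedMap_inr {T : E →L[ℝ] E} (hT : ∀ w, T w = μ₀ • w - L w + a w • c)
    (hLc : L c = μ₀ • c) :
    fderiv ℝ (reducedMap L B a c μ₀) 0 ∘L .inr ℝ ℝ E = T := by
  have h1 : HasFDerivAt (reducedMap L B a c μ₀) (fderiv ℝ (reducedMap L B a c μ₀) 0)
      (ContinuousLinearMap.inr ℝ ℝ E 0) := by
    rw [map_zero]
    exact (contDiff_reducedMap.differentiable (by simp) 0).hasFDerivAt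
  have h2 := h1.comp (0 : E) (ContinuousLinearMap.inr ℝ ℝ E).hasFDerivAt
  -- At ε = 0 the quadratic term B drops out; since L c = μ₀ c, only T and a remainder of second
  -- order in w are left.
  have h3 : reducedMap L B a c μ₀ ∘ ContinuousLinearMap.inr ℝ ℝ E =
      fun w => T w + a w • (w - a w • c) := by
    ext w
    simp only [Function.comp, reducedMap, ContinuousLinearMap.inr_apply, zero_smul, sub_zero, hT,
      map_sub, map_add, map_smul, hLc]
    module
  rw [h3] at h2
  have h4 : HasFDerivAt (fun w => T w + a w • (w - a w • c)) T (0 : E) := by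
    have h5 : HasFDerivAt (fun w : E => w - a w • c) (.id ℝ E - a.smulRight c) 0 :=
      (hasFDerivAt_id 0).sub (a.smulRight c).hasFDerivAt
    have h6 : HasFDerivAt (fun w => T w + a w • (w - a w • c)) _ (0 : E) :=
      T.hasFDerivAt.add ((a.hasFDerivAt (x := 0)).smul h5)
    simpa using h6
  exact h2.unique h4

theorem exists_reduced_branch [CompleteSpace E] (T : E ≃L[ℝ] E)
    (hT : ∀ w, T w = μ₀ • w - L w + a w • c) (hLc : L c = μ₀ • c) :
    ∃ w : ℝ → E, AnalyticAt ℝ w 0 ∧ w 0 = 0 ∧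
      (∀ᶠ ε in 𝓝 (0 : ℝ), reducedMap L B a c μ₀ (ε, w ε) = 0) ∧
      ∀ᶠ p in 𝓝 (0 : ℝ × E), reducedMap L B a c μ₀ p = 0 → p.2 = w p.1 := by
  have hcd : ContDiffAt ℝ ω (reducedMap L B a c μ₀) 0 := contDiff_reducedMap.contDiffAt
  have hi : (fderiv ℝ (reducedMap L B a c μ₀) 0 ∘L .inr ℝ ℝ E).IsInvertible := by
    rw [fderiv_reducedMap_inr (T := T) hT hLc]
    exact ⟨T, rfl⟩
  have h0 : reducedMap L B a c μ₀ 0 = 0 := by simp [reducedMap, hLc]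
  refine ⟨hcd.implicitFunction (by simp) hi,
    (hcd.contDiffAt_implicitFunction (by simp) hi).analyticAt,
    hcd.implicitFunction_apply_self (by simp) hi, ?_, ?_⟩
  · simpa only [h0] using! hcd.eventually_apply_implicitFunction (by simp) hi
  · filter_upwards [hcd.eventually_apply_eq_iff_implicitFunction (by simp) hi] with p hp h
    rw [h0] at hp
    exact (hp.1 h).symm

/-- **Crandall-Rabinowitz theorem** for the equation `μ u - L u - B u u = 0` at a simple eigenvalue
`μ₀` of `L` with eigenvector `c` and spectral coordinate `a`. -/
theorem exists_analytic_branch [CompleteSpace E] (B : E →L[ℝ] E →L[ℝ] E) (T : E ≃L[ℝ] E)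
    (hT : ∀ w, T w = μ₀ • w - L w + a w • c) (hLc : L c = μ₀ • c) (hac : a c = 1)
    (haL : ∀ w, a (L w) = μ₀ * a w) :
    ∃ (φ : ℝ → E) (μ : ℝ → ℝ), AnalyticAt ℝ φ 0 ∧ AnalyticAt ℝ μ 0 ∧ φ 0 = 0 ∧ μ 0 = μ₀ ∧
      HasDerivAt φ c 0 ∧ (∀ ε, a (φ ε) = ε) ∧
      (∀ᶠ ε in 𝓝 (0 : ℝ), μ ε • φ ε - L (φ ε) - B (φ ε) (φ ε) = 0) ∧
      ∀ᶠ p : E × ℝ in 𝓝 (0, μ₀), p.2 • p.1 - L p.1 - B p.1 p.1 = 0 → p.1 ≠ 0 →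
        p = (φ (a p.1), μ (a p.1)) := by
  obtain ⟨w, hwa, hw0, hw, huniq⟩ := exists_reduced_branch (B := B) T hT hLc
  have hua : AnalyticAt ℝ (fun ε => c + w ε - a (w ε) • c) 0 :=
    (analyticAt_const.add hwa).sub (((a.analyticAt _).comp hwa).smul analyticAt_const)
  refine ⟨fun ε => ε • (c + w ε - a (w ε) • c), fun ε => μ₀ + a (w ε), analyticAt_id.smul hua,
    analyticAt_const.add ((a.analyticAt _).comp hwa), by simp, by simp [hw0], ?_, by simp [hac],
    ?_, ?_⟩
  · have h := (hasDerivAt_id (0 : ℝ)).smul hua.differentiableAt.hasDerivAt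
    simpa [hw0, Pi.smul_def'] using h
  · filter_upwards [hw] with ε h
    have h' := congrArg (ε • ·) h
    simp only [reducedMap, smul_zero] at h'
    rw [← h']
    simp only [map_smul, smul_apply]
    module
  · obtain ⟨δ, hδ, hball⟩ := Metric.eventually_nhds_iff_ball.1 huniq
    set M : ℝ := ‖(T.symm : E →L[ℝ] E)‖ * (‖B‖ + ‖a‖ * ‖B‖ * ‖c‖) with hM
    have hev : ∀ (f : E × ℝ → ℝ) (η : ℝ), Continuous f → f (0, μ₀) = 0 → 0 < η →
        ∀ᶠ p in 𝓝 ((0, μ₀) : E × ℝ), f p < η := fun f η hf h0 hη =>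
      hf.continuousAt.eventually_lt_const (by rwa [h0])
    filter_upwards [hev (fun p => |a p.1|) δ (by fun_prop) (by simp) hδ,
      hev (fun p => 2 * (M * ‖p.1‖ * ‖c‖) + |p.2 - μ₀| * ‖c‖) δ (by fun_prop) (by simp) hδ,
      hev (fun p => ‖(T.symm : E →L[ℝ] E)‖ * |p.2 - μ₀|) (1 / 4) (by fun_prop) (by simp)
        (by norm_num),
      hev (fun p => M * ‖p.1‖) (1 / 4) (by fun_prop) (by simp) (by norm_num)]
    rintro ⟨u, m⟩ hd1 hd2 hd3 hd4 hF hu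
    simp only at hd1 hd2 hd3 hd4 hF hu
    set z := u - a u • c with hz
    have haz : a z = 0 := by simp [hz, hac]
    -- Applying a to the equation gives a(B u u) = (m - μ₀) a(u), which removes the component along
    -- c. The rank-one part of T vanishes on z because a(z) = 0.
    have hTz : T z = B u u - a (B u u) • c - (m - μ₀) • z := by
      have h1 : B u u = m • u - L u := (sub_eq_zero.1 hF).symm
      have h2 : a (B u u) = (m - μ₀) * a u := by
        rw [h1, map_sub, map_smul, haL, smul_eq_mul]
        ring
      rw [hT, haz, h2, h1, hz, map_sub, map_smul, hLc]
      module
    have hzle : ‖z‖ ≤ M * ‖u‖ * ‖u‖ + ‖(T.symm : E →L[ℝ] E)‖ * |m - μ₀| * ‖z‖ := by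
      have h1 : ‖z‖ ≤ ‖(T.symm : E →L[ℝ] E)‖ * ‖T z‖ := by
        simpa using (T.symm : E →L[ℝ] E).le_opNorm (T z)
      have hBu : ‖B u u‖ ≤ ‖B‖ * ‖u‖ * ‖u‖ := B.le_opNorm₂ u u
      have haB : ‖a (B u u)‖ ≤ ‖a‖ * (‖B‖ * ‖u‖ * ‖u‖) :=
        (a.le_opNorm _).trans (by gcongr)
      have h2 : ‖T z‖ ≤ ‖B‖ * ‖u‖ * ‖u‖ + ‖a‖ * (‖B‖ * ‖u‖ * ‖u‖) * ‖c‖ + |m - μ₀| * ‖z‖ := by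
        rw [hTz]
        refine (norm_sub_le _ _).trans (add_le_add ((norm_sub_le _ _).trans
          (add_le_add hBu ?_)) ?_)
        · rw [norm_smul]
          gcongr
        · rw [norm_smul, Real.norm_eq_abs]
      refine h1.trans ((mul_le_mul_of_nonneg_left h2 (norm_nonneg _)).trans_eq ?_)
      rw [hM]
      ring
    have hule : ‖u‖ ≤ |a u| * ‖c‖ + ‖z‖ := by
      have : u = a u • c + z := by simp [hz]
      calc ‖u‖ = ‖a u • c + z‖ := congrArg _ this
        _ ≤ _ := (norm_add_le _ _).trans_eq (by rw [norm_smul, Real.norm_eq_abs])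
    have hM0 : 0 ≤ M := by positivity
    -- Two terms of size at most ‖z‖/4 are absorbed on the left, whence the factor 2. The resulting
    -- factor |a u| forces a(u) ≠ 0 when u ≠ 0, and makes z / a(u) small.
    have hz2 : ‖z‖ ≤ 2 * (M * ‖u‖ * ‖c‖) * |a u| := by
      have h1 : M * ‖u‖ * ‖u‖ ≤ M * ‖u‖ * (|a u| * ‖c‖ + ‖z‖) := by gcongr
      have h2 : M * ‖u‖ * ‖z‖ ≤ 1 / 4 * ‖z‖ := by gcongr
      have h3 : ‖(T.symm : E →L[ℝ] E)‖ * |m - μ₀| * ‖z‖ ≤ 1 / 4 * ‖z‖ := by gcongr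
      linarith
    have hε : a u ≠ 0 := by
      intro h0
      rw [h0, abs_zero, mul_zero] at hz2
      rw [h0, abs_zero, zero_mul, zero_add] at hule
      exact hu (norm_le_zero_iff.1 (hule.trans hz2))
    -- The change of variables inverted: this is the w that encodes the solution (u, m) at ε = a(u).
    set v := (a u)⁻¹ • z + (m - μ₀) • c with hv
    have hav : a v = m - μ₀ := by simp [hv, haz, hac]
    have huv : c + v - a v • c = (a u)⁻¹ • u := by
      rw [hav, hv, hz, smul_sub, smul_smul, inv_mul_cancel₀ hε]
      module
    have hvle : ‖v‖ < δ := by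
      refine lt_of_le_of_lt ((norm_add_le _ _).trans (add_le_add ?_ (norm_smul_le _ _))) hd2
      rw [norm_smul, norm_inv, Real.norm_eq_abs, inv_mul_le_iff₀ (abs_pos.2 hε), mul_comm]
      exact hz2
    have hvw : v = w (a u) := by
      refine hball (a u, v) ?_ ?_
      · rw [Metric.mem_ball, dist_zero_right, Prod.norm_def]
        exact max_lt hd1 hvle
      · have h1 : reducedMap L B a c μ₀ (a u, v) = (a u)⁻¹ • (m • u - L u - B u u) := by
          simp only [reducedMap, huv]
          simp only [hav, map_smul, smul_apply]
          rw [smul_smul (a u), mul_inv_cancel₀ hε]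
          module
        rw [h1, hF, smul_zero]
    refine Prod.ext ?_ ?_
    · simp only [← hvw, huv, smul_smul, mul_inv_cancel₀ hε, one_smul]
    · simp [← hvw, hav]

/-- If the data of the bifurcation problem preserve a closed subspace, then so does the bifurcating
branch. -/
theorem exists_analytic_branch_mem [CompleteSpace E] (B : E →L[ℝ] E →L[ℝ] E) (T : E ≃L[ℝ] E)
    (hT : ∀ w, T w = μ₀ • w - L w + a w • c) (hLc : L c = μ₀ • c) (hac : a c = 1)
    (haL : ∀ w, a (L w) = μ₀ * a w) (S : Submodule ℝ E) (hS : IsClosed (S : Set E)) (hc : c ∈ S)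
    (hL : ∀ w ∈ S, L w ∈ S) (hTS : ∀ w ∈ S, T.symm w ∈ S)
    (hB : ∀ v ∈ S, ∀ w ∈ S, B v w ∈ S) :
    ∃ (φ : ℝ → E) (μ : ℝ → ℝ), AnalyticAt ℝ φ 0 ∧ AnalyticAt ℝ μ 0 ∧ φ 0 = 0 ∧ μ 0 = μ₀ ∧
      HasDerivAt φ c 0 ∧ (∀ ε, a (φ ε) = ε) ∧ (∀ᶠ ε in 𝓝 (0 : ℝ), φ ε ∈ S) ∧
      (∀ᶠ ε in 𝓝 (0 : ℝ), μ ε • φ ε - L (φ ε) - B (φ ε) (φ ε) = 0) ∧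
      ∀ᶠ p : E × ℝ in 𝓝 (0, μ₀), p.2 • p.1 - L p.1 - B p.1 p.1 = 0 → p.1 ≠ 0 →
        p = (φ (a p.1), μ (a p.1)) := by
  obtain ⟨φ, μ, h1, h2, h3, h4, h5, h6, h7, h8⟩ := exists_analytic_branch B T hT hLc hac haL
  refine ⟨φ, μ, h1, h2, h3, h4, h5, h6, ?_, h7, h8⟩
  have : CompleteSpace S := hS.completeSpace_coe
  have hTS' : ∀ w ∈ S, T w ∈ S := fun w hw => by
    rw [hT]
    exact S.add_mem (S.sub_mem (S.smul_mem _ hw) (hL w hw)) (S.smul_mem _ hc)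
  let T' : S ≃L[ℝ] S := ContinuousLinearEquiv.equivOfInverse
    (((T : E →L[ℝ] E).comp S.subtypeL).codRestrict S fun w => hTS' w w.2)
    (((T.symm : E →L[ℝ] E).comp S.subtypeL).codRestrict S fun w => hTS w w.2)
    (fun w => Subtype.ext (T.symm_apply_apply (w : E)))
    (fun w => Subtype.ext (T.apply_symm_apply (w : E)))
  let B' : S →L[ℝ] S →L[ℝ] S := LinearMap.mkContinuous₂
    (LinearMap.mk₂ ℝ (fun v w : S => (⟨B v w, hB v v.2 w w.2⟩ : S))
      (fun _ _ _ => Subtype.ext (by simp)) (fun _ _ _ => Subtype.ext (by simp))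
      (fun _ _ _ => Subtype.ext (by simp)) (fun _ _ _ => Subtype.ext (by simp))) ‖B‖
    (fun v w => B.le_opNorm₂ v w)
  -- Existence is applied inside S. The resulting branch also solves the equation in E, so
  -- uniqueness there identifies it with φ, both being parametrised by a.
  obtain ⟨ψ, ν, -, hν, hψ0, hν0, hψ', hψa, hψ, -⟩ :=
    exists_analytic_branch (L := (L.comp S.subtypeL).codRestrict S fun w => hL w w.2)
      (a := a.comp S.subtypeL) (c := ⟨c, hc⟩) (μ₀ := μ₀) B' T'
      (fun w => Subtype.ext (hT w)) (Subtype.ext hLc) hac (fun w => haL w)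
  have ht : Tendsto (fun ε => ((ψ ε : E), ν ε)) (𝓝 0) (𝓝 (0, μ₀)) := by
    have h := ((continuous_subtype_val.continuousAt.comp hψ'.continuousAt).prodMk
      hν.continuousAt).tendsto
    simpa [Function.comp_def, hψ0, hν0] using h
  filter_upwards [hψ, ht.eventually h8] with ε hε hε'
  by_cases h0 : ε = 0
  · rw [h0, h3]
    exact S.zero_mem
  have hne : (ψ ε : E) ≠ 0 := fun h => h0 (by rw [← hψa ε]; simp [h])
  have h := hε' (congrArg Subtype.val hε) hne
  have ha : a (ψ ε) = ε := hψa ε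
  rw [ha] at h
  have h' : (ψ ε : E) = φ ε := congrArg Prod.fst h
  exact h' ▸ (ψ ε).2

end AbstractBifurcation

/-! ### Pointwise estimates in the Hölder space, and its completeness. -/

namespace HolderZeroEven

variable {α : ℝ}

theorem holderWith_of_abs_sub_le {β : ℝ≥0} {g : ℝ → ℝ} {A : ℝ}
    (h : ∀ x y, |g x - g y| ≤ A * |x - y| ^ (β : ℝ)) : HolderWith A.toNNReal β g := by
  intro x y
  rw [edist_dist, edist_dist, ENNReal.ofReal_rpow_of_nonneg dist_nonneg β.coe_nonneg]
  change _ ≤ ENNReal.ofReal A * _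
  rw [← ENNReal.ofReal_mul' (by positivity)]
  exact ENNReal.ofReal_le_ofReal (h x y)

/-- The element of `C^α_{0,even}` given by a differentiable function and its derivative. -/
def mk (f f' : ℝ → ℝ) (A : ℝ) (hper : Function.Periodic f (2 * Real.pi))
    (hd : ∀ x, HasDerivAt f (f' x) x)
    (hH : ∀ x y, |f' x - f' y| ≤ A * |x - y| ^ ((α - 1).toNNReal : ℝ))
    (hint : (∫ x in (-Real.pi)..Real.pi, f x) = 0) (heven : Function.Even f) :
    HolderZeroEven α :=
  ⟨f, hper, fun x => (hd x).differentiableAt,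
    (funext fun x => (hd x).deriv : deriv f = f') ▸ (holderWith_of_abs_sub_le hH).memHolder,
    hint, heven⟩

theorem hasDerivAt (f : HolderZeroEven α) (x : ℝ) : HasDerivAt f (deriv f x) x :=
  (f.differentiable x).hasDerivAt

theorem abs_apply_le (f : HolderZeroEven α) (x : ℝ) : |f x| ≤ ‖f‖ := by
  have h1 := le_ciSup f.bddAbove_abs x
  have h2 : 0 ≤ ⨆ x, |deriv f x| := Real.iSup_nonneg fun x => abs_nonneg _
  have h3 : (0 : ℝ) ≤ nnHolderNorm (α - 1).toNNReal (deriv f) := NNReal.coe_nonneg _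
  rw [norm_def]
  linarith

theorem abs_deriv_le (f : HolderZeroEven α) (x : ℝ) : |deriv f x| ≤ ‖f‖ := by
  have h1 := le_ciSup f.bddAbove_abs_deriv x
  have h2 : 0 ≤ ⨆ x, |f x| := Real.iSup_nonneg fun x => abs_nonneg _
  have h3 : (0 : ℝ) ≤ nnHolderNorm (α - 1).toNNReal (deriv f) := NNReal.coe_nonneg _
  rw [norm_def]
  linarith

theorem abs_deriv_sub_le (f : HolderZeroEven α) (x y : ℝ) :
    |deriv f x - deriv f y| ≤ ‖f‖ * |x - y| ^ ((α - 1).toNNReal : ℝ) := by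
  have h1 := f.memHolder_deriv.holderWith.dist_le x y
  have h2 : 0 ≤ ⨆ x, |f x| := Real.iSup_nonneg fun x => abs_nonneg _
  have h3 : 0 ≤ ⨆ x, |deriv f x| := Real.iSup_nonneg fun x => abs_nonneg _
  rw [Real.dist_eq, Real.dist_eq] at h1
  refine h1.trans (mul_le_mul_of_nonneg_right ?_ (by positivity))
  rw [norm_def]
  linarith

/-- The factor 3 counts the three parts of the norm. -/
theorem norm_le_of_hasDerivAt {f : HolderZeroEven α} {f' : ℝ → ℝ} {A : ℝ}
    (hd : ∀ x, HasDerivAt f (f' x) x) (h0 : ∀ x, |f x| ≤ A) (h1 : ∀ x, |f' x| ≤ A)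
    (h2 : ∀ x y, |f' x - f' y| ≤ A * |x - y| ^ ((α - 1).toNNReal : ℝ)) : ‖f‖ ≤ 3 * A := by
  have hA : 0 ≤ A := (abs_nonneg _).trans (h0 0)
  have hf' : deriv f = f' := funext fun x => (hd x).deriv
  have h3 : (nnHolderNorm (α - 1).toNNReal (deriv f) : ℝ) ≤ A := by
    rw [hf']
    exact (NNReal.coe_le_coe.2 (holderWith_of_abs_sub_le h2).nnholderNorm_le).trans_eq
      (Real.coe_toNNReal A hA)
  have h4 : (⨆ x, |f x|) ≤ A := ciSup_le h0
  have h5 : (⨆ x, |deriv f x|) ≤ A := hf' ▸ ciSup_le h1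
  rw [norm_def]
  linarith

theorem coe_sub (f g : HolderZeroEven α) : ⇑(f - g) = ⇑f - ⇑g := rfl

theorem deriv_coe_sub (f g : HolderZeroEven α) (x : ℝ) :
    deriv ⇑(f - g) x = deriv ⇑f x - deriv ⇑g x :=
  ((f.hasDerivAt x).sub (g.hasDerivAt x)).deriv

/-- Evaluation at a point as a continuous linear functional. -/
noncomputable def eval (x : ℝ) : HolderZeroEven α →L[ℝ] ℝ :=
  LinearMap.mkContinuous (IsLinearMap.mk' (fun f : HolderZeroEven α => f x)
    ⟨fun _ _ => rfl, fun _ _ => rfl⟩) 1 fun f => by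
      rw [one_mul]
      exact f.abs_apply_le x

instance : CompleteSpace (HolderZeroEven α) := by
  refine Metric.complete_of_cauchySeq_tendsto fun u hu => ?_
  obtain ⟨b, hb0, hb, hblim⟩ := cauchySeq_iff_le_tendsto_0.1 hu
  -- Used for the values and the derivatives at a point, to obtain the pointwise limits f and g; the
  -- norm estimates then pass to the limit in the second index.
  have key : ∀ F : HolderZeroEven α → ℝ, (∀ v w, |F v - F w| ≤ ‖v - w‖) →
      ∃ l, Tendsto (fun n => F (u n)) atTop (𝓝 l) := by
    intro F hF
    refine cauchySeq_tendsto_of_complete (cauchySeq_iff_le_tendsto_0.2 ⟨b, hb0, ?_, hblim⟩)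
    intro n m N hn hm
    exact (hF _ _).trans ((dist_eq_norm (u n) (u m)).symm.trans_le (hb n m N hn hm))
  choose f hf using fun x => key (fun v => v x) fun v w => (v - w).abs_apply_le x
  choose g hg using fun x => key (fun v => deriv v x) fun v w => by
    rw [← deriv_coe_sub]
    exact (v - w).abs_deriv_le x
  have hnm : ∀ n m N, N ≤ n → N ≤ m → ‖u n - u m‖ ≤ b N := fun n m N hn hm =>
    (dist_eq_norm (u n) (u m)).symm.trans_le (hb n m N hn hm)
  have hf' : ∀ N x, |u N x - f x| ≤ b N := fun N x =>
    le_of_tendsto (tendsto_const_nhds.sub (hf x)).abs ((eventually_ge_atTop N).mono fun m hm =>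
      ((u N - u m).abs_apply_le x).trans (hnm N m N le_rfl hm))
  have hg' : ∀ N x, |deriv (u N) x - g x| ≤ b N := fun N x =>
    le_of_tendsto (tendsto_const_nhds.sub (hg x)).abs ((eventually_ge_atTop N).mono fun m hm => by
      rw [← deriv_coe_sub]
      exact ((u N - u m).abs_deriv_le x).trans (hnm N m N le_rfl hm))
  have hh' : ∀ N x y, |(deriv (u N) x - g x) - (deriv (u N) y - g y)| ≤
      b N * |x - y| ^ ((α - 1).toNNReal : ℝ) := fun N x y =>
    le_of_tendsto ((tendsto_const_nhds.sub (hg x)).sub (tendsto_const_nhds.sub (hg y))).abs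
      ((eventually_ge_atTop N).mono fun m hm => by
        rw [← deriv_coe_sub, ← deriv_coe_sub]
        exact ((u N - u m).abs_deriv_sub_le x y).trans
          (mul_le_mul_of_nonneg_right (hnm N m N le_rfl hm) (by positivity)))
  have hunif : ∀ (F : ℕ → ℝ → ℝ) (G : ℝ → ℝ), (∀ N x, |F N x - G x| ≤ b N) →
      TendstoUniformly F G atTop := fun F G h => by
    refine Metric.tendstoUniformly_iff.2 fun ε hε => ?_
    filter_upwards [hblim.eventually_lt_const hε] with N hN x
    rw [dist_comm]
    exact (h N x).trans_lt hN
  have hd : ∀ x, HasDerivAt f (g x) x := hasDerivAt_of_tendstoUniformly (hunif _ _ hg')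
    (Eventually.of_forall fun n x => (u n).hasDerivAt x) hf
  have hH : ∀ x y, |g x - g y| ≤ (‖u 0‖ + b 0) * |x - y| ^ ((α - 1).toNNReal : ℝ) := by
    intro x y
    have h1 := hh' 0 x y
    have h2 := (u 0).abs_deriv_sub_le x y
    have h3 := abs_sub (deriv (u 0) x - deriv (u 0) y)
      ((deriv (u 0) x - g x) - (deriv (u 0) y - g y))
    rw [show deriv (u 0) x - deriv (u 0) y - ((deriv (u 0) x - g x) - (deriv (u 0) y - g y)) =
      g x - g y by ring] at h3
    linarith
  have hper : Function.Periodic f (2 * Real.pi) := fun x =>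
    tendsto_nhds_unique (hf _) ((hf x).congr fun n => ((u n).periodic x).symm)
  have heven : Function.Even f := fun x =>
    tendsto_nhds_unique (hf _) ((hf x).congr fun n => ((u n).even x).symm)
  have hcont : Continuous f := continuous_iff_continuousAt.2 fun x => (hd x).continuousAt
  have hint : (∫ x in (-Real.pi)..Real.pi, f x) = 0 := by
    have h1 : ∀ n, |∫ x in (-Real.pi)..Real.pi, f x| ≤ b n * |Real.pi - -Real.pi| := by
      intro n
      have h2 : (∫ x in (-Real.pi)..Real.pi, f x) = -∫ x in (-Real.pi)..Real.pi, (u n x - f x) := by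
        rw [intervalIntegral.integral_sub ((u n).differentiable.continuous.intervalIntegrable _ _)
          (hcont.intervalIntegrable _ _), (u n).integral_eq_zero]
        ring
      rw [h2, abs_neg]
      exact intervalIntegral.norm_integral_le_of_norm_le_const fun x _ =>
        (Real.norm_eq_abs _).trans_le (hf' n x)
    have h3 := ge_of_tendsto' (hblim.mul_const _) h1
    rw [zero_mul] at h3
    exact abs_nonpos_iff.1 h3
  refine ⟨mk f g _ hper hd hH hint heven, ?_⟩
  rw [tendsto_iff_norm_sub_tendsto_zero]
  refine squeeze_zero (fun _ => norm_nonneg _) (fun N => ?_) (by simpa using hblim.const_mul 3)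
  exact norm_le_of_hasDerivAt (fun x => ((u N).hasDerivAt x).sub (hd x)) (hf' N) (hg' N) (hh' N)

end HolderZeroEven

/-! ### The product as a bounded bilinear map. -/

/-- The Lipschitz bound serves for |x - y| ≤ 1 and the sup bound for |x - y| ≥ 1. -/
theorem abs_sub_le_rpow_of_bounded_of_lipschitz {h : ℝ → ℝ} {A β : ℝ} (hβ0 : 0 ≤ β) (hβ1 : β ≤ 1)
    (hb : ∀ x, |h x| ≤ A) (hl : ∀ x y, |h x - h y| ≤ A * |x - y|) (x y : ℝ) :
    |h x - h y| ≤ 2 * A * |x - y| ^ β := by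
  have hA : 0 ≤ A := (abs_nonneg _).trans (hb 0)
  rcases le_total |x - y| 1 with h1 | h1
  · have h2 := Real.self_le_rpow_of_le_one (abs_nonneg (x - y)) h1 hβ1
    have h3 : 0 ≤ A * |x - y| ^ β := by positivity
    have h4 := mul_le_mul_of_nonneg_left h2 hA
    linarith [hl x y]
  · have h2 := Real.one_le_rpow h1 hβ0
    have h3 : |h x - h y| ≤ 2 * A := by
      have := abs_sub (h x) (h y)
      linarith [hb x, hb y]
    exact h3.trans (le_mul_of_one_le_right (by positivity) h2)

theorem abs_sub_le_of_hasDerivAt {h h' : ℝ → ℝ} {A : ℝ} (hd : ∀ x, HasDerivAt h (h' x) x)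
    (hb : ∀ x, |h' x| ≤ A) (x y : ℝ) : |h x - h y| ≤ A * |x - y| :=
  Convex.norm_image_sub_le_of_norm_hasDerivWithin_le (fun z _ => (hd z).hasDerivWithinAt)
    (fun z _ => hb z) convex_univ (Set.mem_univ y) (Set.mem_univ x)

namespace HolderZeroEven

variable {α : ℝ}

theorem continuous (f : HolderZeroEven α) : Continuous f := f.differentiable.continuous

theorem abs_apply_sub_le (hα : α ≤ 2) (f : HolderZeroEven α) (x y : ℝ) :
    |f x - f y| ≤ 2 * ‖f‖ * |x - y| ^ ((α - 1).toNNReal : ℝ) := by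
  refine abs_sub_le_rpow_of_bounded_of_lipschitz (NNReal.coe_nonneg _) ?_ f.abs_apply_le
    (abs_sub_le_of_hasDerivAt f.hasDerivAt f.abs_deriv_le) x y
  rw [Real.coe_toNNReal']
  exact max_le (by linarith) zero_le_one

/-- The mean value of a function on the torus. -/
noncomputable def torusMean (f : ℝ → ℝ) : ℝ := (2 * Real.pi)⁻¹ * ∫ x in (-Real.pi)..Real.pi, f x

theorem abs_torusMean_le {f : ℝ → ℝ} {A : ℝ} (h : ∀ x, |f x| ≤ A) : |torusMean f| ≤ A := by
  have h1 : |∫ x in (-Real.pi)..Real.pi, f x| ≤ A * |Real.pi - -Real.pi| :=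
    intervalIntegral.norm_integral_le_of_norm_le_const fun x _ =>
      (Real.norm_eq_abs (f x)).trans_le (h x)
  rw [show Real.pi - -Real.pi = 2 * Real.pi by ring, abs_of_pos Real.two_pi_pos] at h1
  rw [torusMean, abs_mul, abs_inv, abs_of_pos Real.two_pi_pos,
    inv_mul_le_iff₀ Real.two_pi_pos]
  linarith

/-- Half the product of two functions, without its mean. -/
noncomputable def halfMulFun (f g : ℝ → ℝ) (x : ℝ) : ℝ :=
  (f x * g x - torusMean fun y => f y * g y) / 2

theorem hasDerivAt_halfMulFun (f g : HolderZeroEven α) (x : ℝ) :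
    HasDerivAt (halfMulFun f g) ((deriv f x * g x + f x * deriv g x) / 2) x :=
  (((f.hasDerivAt x).mul (g.hasDerivAt x)).sub_const _).div_const 2

theorem abs_mul_apply_le (f g : HolderZeroEven α) (x : ℝ) : |f x * g x| ≤ ‖f‖ * ‖g‖ := by
  rw [abs_mul]
  exact mul_le_mul (f.abs_apply_le x) (g.abs_apply_le x) (abs_nonneg _) (norm_nonneg _)

/-- Leibniz rule: in f'g the variation of f' contributes 1 to the constant and that of g, bounded
and Lipschitz, contributes 2. The two Leibniz terms are averaged by the factor 1/2. -/
theorem abs_deriv_halfMulFun_sub_le (hα : α ≤ 2) (f g : HolderZeroEven α) (x y : ℝ) :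
    |(deriv f x * g x + f x * deriv g x) / 2 - (deriv f y * g y + f y * deriv g y) / 2| ≤
      3 * (‖f‖ * ‖g‖) * |x - y| ^ ((α - 1).toNNReal : ℝ) := by
  have key : ∀ f g : HolderZeroEven α, |deriv f x * g x - deriv f y * g y| ≤
      3 * (‖f‖ * ‖g‖) * |x - y| ^ ((α - 1).toNNReal : ℝ) := fun f g => by
    set R := |x - y| ^ ((α - 1).toNNReal : ℝ) with hR
    have hR0 : 0 ≤ R := by positivity
    have h1 : |(deriv f x - deriv f y) * g x| ≤ (‖f‖ * R) * ‖g‖ := by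
      rw [abs_mul]
      exact mul_le_mul (f.abs_deriv_sub_le x y) (g.abs_apply_le x) (abs_nonneg _) (by positivity)
    have h2 : |deriv f y * (g x - g y)| ≤ ‖f‖ * (2 * ‖g‖ * R) := by
      rw [abs_mul]
      exact mul_le_mul (f.abs_deriv_le y) (g.abs_apply_sub_le hα x y) (abs_nonneg _)
        (norm_nonneg _)
    calc |deriv f x * g x - deriv f y * g y|
        = |(deriv f x - deriv f y) * g x + deriv f y * (g x - g y)| := by congr 1; ring
      _ ≤ _ := abs_add_le _ _
      _ ≤ _ := add_le_add h1 h2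
      _ = _ := by ring
  have h1 := key f g
  have h2 := key g f
  have h3 := abs_add_le (deriv f x * g x - deriv f y * g y) (deriv g x * f x - deriv g y * f y)
  rw [show (deriv f x * g x + f x * deriv g x) / 2 - (deriv f y * g y + f y * deriv g y) / 2 =
    ((deriv f x * g x - deriv f y * g y) + (deriv g x * f x - deriv g y * f y)) / 2 by ring,
    abs_div, abs_two]
  rw [mul_comm ‖g‖] at h2
  linarith

/-- Half the product of two elements of `C^α_{0,even}`, projected to mean zero. -/
noncomputable def halfMul (hα : α ≤ 2) (f g : HolderZeroEven α) : HolderZeroEven α :=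
  mk (halfMulFun f g) (fun x => (deriv f x * g x + f x * deriv g x) / 2) (3 * (‖f‖ * ‖g‖))
    (fun x => by simp only [halfMulFun, f.periodic x, g.periodic x])
    (hasDerivAt_halfMulFun f g) (abs_deriv_halfMulFun_sub_le hα f g)
    (by
      have h : Continuous fun x => f x * g x := f.continuous.mul g.continuous
      simp only [halfMulFun, torusMean]
      rw [intervalIntegral.integral_div, intervalIntegral.integral_sub (h.intervalIntegrable _ _)
        (by simp), intervalIntegral.integral_const, smul_eq_mul]
      field_simp
      ring)
    (fun x => by simp only [halfMulFun, f.even x, g.even x])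

theorem norm_halfMul_le (hα : α ≤ 2) (f g : HolderZeroEven α) :
    ‖halfMul hα f g‖ ≤ 9 * ‖f‖ * ‖g‖ := by
  have h0 : 0 ≤ ‖f‖ * ‖g‖ := by positivity
  refine (norm_le_of_hasDerivAt (f := halfMul hα f g) (A := 3 * (‖f‖ * ‖g‖))
    (hasDerivAt_halfMulFun f g) (fun x => ?_)
    (fun x => ?_) (abs_deriv_halfMulFun_sub_le hα f g)).trans_eq (by ring)
  · change |(f x * g x - torusMean fun y => f y * g y) / 2| ≤ _
    rw [abs_div, abs_two]
    have h1 := abs_sub (f x * g x) (torusMean fun y => f y * g y)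
    linarith [abs_mul_apply_le f g x, abs_torusMean_le (abs_mul_apply_le f g)]
  · rw [abs_div, abs_two]
    have h1 := abs_add_le (deriv f x * g x) (f x * deriv g x)
    have h2 : |deriv f x * g x| ≤ ‖f‖ * ‖g‖ := by
      rw [abs_mul]
      exact mul_le_mul (f.abs_deriv_le x) (g.abs_apply_le x) (abs_nonneg _) (norm_nonneg _)
    have h3 : |f x * deriv g x| ≤ ‖f‖ * ‖g‖ := by
      rw [abs_mul]
      exact mul_le_mul (f.abs_apply_le x) (g.abs_deriv_le x) (abs_nonneg _) (norm_nonneg _)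
    linarith

theorem torusMean_add {f g : ℝ → ℝ} (hf : Continuous f) (hg : Continuous g) :
    (torusMean fun x => f x + g x) = torusMean f + torusMean g := by
  simp only [torusMean]
  rw [intervalIntegral.integral_add (hf.intervalIntegrable _ _) (hg.intervalIntegrable _ _),
    mul_add]

theorem torusMean_const_mul (c : ℝ) (f : ℝ → ℝ) :
    (torusMean fun x => c * f x) = c * torusMean f := by
  simp only [torusMean]
  rw [intervalIntegral.integral_const_mul]
  ring

theorem halfMul_comm (hα : α ≤ 2) (f g : HolderZeroEven α) : halfMul hα f g = halfMul hα g f :=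
  ext' (funext fun x => by
    change halfMulFun f g x = halfMulFun g f x
    simp only [halfMulFun, mul_comm])

theorem halfMul_add_left (hα : α ≤ 2) (f₁ f₂ g : HolderZeroEven α) :
    halfMul hα (f₁ + f₂) g = halfMul hα f₁ g + halfMul hα f₂ g :=
  ext' (funext fun x => by
    change halfMulFun (⇑f₁ + ⇑f₂) g x = halfMulFun f₁ g x + halfMulFun f₂ g x
    simp only [halfMulFun, Pi.add_apply, add_mul]
    have h₁ := f₁.continuous
    have h₂ := f₂.continuous
    have h₃ := g.continuous
    rw [torusMean_add (f := fun y => f₁ y * g y) (by fun_prop) (by fun_prop)]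
    ring)

theorem halfMul_smul_left (hα : α ≤ 2) (c : ℝ) (f g : HolderZeroEven α) :
    halfMul hα (c • f) g = c • halfMul hα f g :=
  ext' (funext fun x => by
    change halfMulFun (c • ⇑f) g x = c * halfMulFun f g x
    simp only [halfMulFun, Pi.smul_apply, smul_eq_mul, mul_assoc]
    rw [torusMean_const_mul]
    ring)

/-- `halfMul` as a continuous bilinear map. -/
noncomputable def halfMulL (hα : α ≤ 2) :
    HolderZeroEven α →L[ℝ] HolderZeroEven α →L[ℝ] HolderZeroEven α :=
  LinearMap.mkContinuous₂ (LinearMap.mk₂ ℝ (halfMul hα) (halfMul_add_left hα)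
    (halfMul_smul_left hα)
    (fun f g₁ g₂ => by rw [halfMul_comm, halfMul_add_left, halfMul_comm, halfMul_comm hα g₂])
    (fun c f g => by rw [halfMul_comm, halfMul_smul_left, halfMul_comm])) 9 (norm_halfMul_le hα)

theorem halfMulL_apply (hα : α ≤ 2) (f g : HolderZeroEven α) (x : ℝ) :
    halfMulL hα f g x = (f x * g x - torusMean fun y => f y * g y) / 2 := rfl

end HolderZeroEven

/-! ### Cosine series, and Fourier multipliers as convolutions. -/

namespace HolderZeroEven

variable {α : ℝ}

/-- The cosine series with coefficients `a`. -/
noncomputable def cosSeries (a : ℕ → ℝ) (x : ℝ) : ℝ := ∑' n : ℕ, a n * Real.cos (n * x)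

theorem norm_mul_cos_le (c y : ℝ) : ‖c * Real.cos y‖ ≤ |c| := by
  rw [norm_mul, Real.norm_eq_abs, Real.norm_eq_abs]
  exact mul_le_of_le_one_right (abs_nonneg _) (Real.abs_cos_le_one y)

theorem summable_cosSeries {a : ℕ → ℝ} (ha : Summable fun n => |a n|) (x : ℝ) :
    Summable fun n : ℕ => a n * Real.cos (n * x) :=
  ha.of_norm_bounded fun _ => norm_mul_cos_le _ _

theorem continuous_cosSeries {a : ℕ → ℝ} (ha : Summable fun n => |a n|) :
    Continuous (cosSeries a) :=
  continuous_tsum (fun n => by fun_prop) ha fun _ _ => norm_mul_cos_le _ _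

theorem abs_cosSeries_le {a : ℕ → ℝ} (ha : Summable fun n => |a n|) (x : ℝ) :
    |cosSeries a x| ≤ ∑' n, |a n| :=
  tsum_of_norm_bounded ha.hasSum fun _ => norm_mul_cos_le _ _

theorem even_cosSeries (a : ℕ → ℝ) : Function.Even (cosSeries a) := fun x => by
  simp only [cosSeries, mul_neg, Real.cos_neg]

theorem torusMean_cosSeries_mul {a : ℕ → ℝ} (ha : Summable fun n => |a n|) {h : ℝ → ℝ}
    (hc : Continuous h) :
    (torusMean fun t => cosSeries a t * h t) =
      ∑' n : ℕ, a n * torusMean fun t => h t * Real.cos (n * t) := by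
  obtain ⟨C, hC⟩ := (isCompact_uIcc (a := -Real.pi) (b := Real.pi)).exists_bound_of_continuousOn
    hc.continuousOn
  have h1 := intervalIntegral.hasSum_integral_of_dominated_convergence
    (μ := MeasureTheory.volume) (a := -Real.pi) (b := Real.pi)
    (F := fun (n : ℕ) t => a n * Real.cos (n * t) * h t) (f := fun t => cosSeries a t * h t)
    (fun n _ => |a n| * C)
    (fun n => (by fun_prop : Continuous _).aestronglyMeasurable)
    (fun n => Eventually.of_forall fun t ht => by
      rw [norm_mul]
      exact mul_le_mul (norm_mul_cos_le _ _) (hC t (Set.uIoc_subset_uIcc ht)) (norm_nonneg _)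
        (abs_nonneg _))
    (Eventually.of_forall fun t _ => ha.mul_right C)
    (by simp)
    (Eventually.of_forall fun t _ => (summable_cosSeries ha t).hasSum.mul_right _)
  simp only [torusMean]
  rw [← h1.tsum_eq, ← tsum_mul_left]
  refine tsum_congr fun n => ?_
  rw [mul_left_comm (a n)]
  congr 1
  rw [← intervalIntegral.integral_const_mul]
  exact intervalIntegral.integral_congr fun t _ => by ring

/-- The cosine coefficients of a function on the torus. -/
noncomputable def cosCoeff (f : ℝ → ℝ) (n : ℕ) : ℝ := torusMean fun t => f t * Real.cos (n * t)

theorem torusMean_cos_int (n : ℤ) :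
    (torusMean fun t => Real.cos (n * t)) = if n = 0 then 1 else 0 := by
  split_ifs with h
  · simp only [torusMean, h, Int.cast_zero, zero_mul, Real.cos_zero,
      intervalIntegral.integral_const, smul_eq_mul]
    field_simp
    ring
  · have h' : (n : ℝ) ≠ 0 := Int.cast_ne_zero.2 h
    rw [torusMean, intervalIntegral.integral_comp_mul_left (fun t => Real.cos t) h', integral_cos,
      mul_neg, Real.sin_neg, Real.sin_int_mul_pi]
    simp

theorem torusMean_cos_mul_cos (n j : ℕ) :
    (torusMean fun t => Real.cos (n * t) * Real.cos (j * t)) =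
      ((if n = j then 1 else 0) + if n + j = 0 then 1 else 0) / 2 := by
  have h : (fun t : ℝ => Real.cos (n * t) * Real.cos (j * t)) = fun t =>
      2⁻¹ * (Real.cos (((n - j : ℤ) : ℝ) * t) + Real.cos (((n + j : ℤ) : ℝ) * t)) := by
    ext t
    push_cast
    rw [sub_mul, add_mul, Real.cos_sub, Real.cos_add]
    ring
  rw [h, torusMean_const_mul, torusMean_add (by fun_prop) (by fun_prop), torusMean_cos_int,
    torusMean_cos_int]
  simp only [sub_eq_zero, Nat.cast_inj, ← Nat.cast_add, Nat.cast_eq_zero]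
  ring

/-- The mean of cos² is 1/2 except for the constant mode, where it is 1; `h0` makes the formula
uniform in j. -/
theorem cosCoeff_cosSeries {a : ℕ → ℝ} (ha : Summable fun n => |a n|) (h0 : a 0 = 0) (j : ℕ) :
    cosCoeff (cosSeries a) j = a j / 2 := by
  rw [cosCoeff, torusMean_cosSeries_mul ha (by fun_prop), tsum_eq_single j]
  · rw [torusMean_cos_mul_cos]
    rcases eq_or_ne j 0 with rfl | hj
    · simp [h0]
    · simp [hj]
      ring
  · intro n hn
    rw [torusMean_cos_mul_cos]
    rcases eq_or_ne n 0 with rfl | hn0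
    · simp [h0]
    · simp [hn0, hn.symm]

theorem cosCoeff_zero (f : HolderZeroEven α) : cosCoeff f 0 = 0 := by
  simp [cosCoeff, torusMean, f.integral_eq_zero]

theorem abs_cosCoeff_le (f : HolderZeroEven α) (n : ℕ) : |cosCoeff f n| ≤ ‖f‖ :=
  abs_torusMean_le fun x => (norm_mul_cos_le _ _).trans (f.abs_apply_le x)

theorem integral_odd_eq_zero {g : ℝ → ℝ} (hg : ∀ x, g (-x) = -g x) :
    (∫ x in (-Real.pi)..Real.pi, g x) = 0 := by
  have h := intervalIntegral.integral_comp_neg (a := -Real.pi) (b := Real.pi) g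
  simp only [hg, intervalIntegral.integral_neg, neg_neg] at h
  linarith

/-- After s = x - t and a shift of the interval by periodicity, the addition formula leaves a sine
integral, which vanishes because f is even. -/
theorem torusMean_translate (f : HolderZeroEven α) (n : ℕ) (x : ℝ) :
    (torusMean fun t => f (x - t) * Real.cos (n * t)) = cosCoeff f n * Real.cos (n * x) := by
  set g : ℝ → ℝ := fun s => f s * Real.cos (n * (x - s)) with hg
  have hper : Function.Periodic g (2 * Real.pi) := fun s => by
    simp only [hg, f.periodic s]
    rw [show (n : ℝ) * (x - (s + 2 * Real.pi)) = n * (x - s) - n * (2 * Real.pi) by ring,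
      Real.cos_sub_nat_mul_two_pi]
  have h1 : (∫ t in (-Real.pi)..Real.pi, f (x - t) * Real.cos (n * t)) =
      ∫ t in (-Real.pi)..Real.pi, g (x - t) := by
    simp only [hg, sub_sub_cancel]
  have h2 := hper.intervalIntegral_add_eq (x - Real.pi) (-Real.pi)
  rw [show x - Real.pi + 2 * Real.pi = x - -Real.pi by ring,
    show -Real.pi + 2 * Real.pi = Real.pi by ring] at h2
  have h3 : ∀ s, g s = Real.cos (n * x) * (f s * Real.cos (n * s)) +
      Real.sin (n * x) * (f s * Real.sin (n * s)) := fun s => by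
    simp only [hg, mul_sub, Real.cos_sub]
    ring
  have hc := f.continuous
  rw [torusMean, h1, intervalIntegral.integral_comp_sub_left, h2]
  simp only [h3]
  rw [intervalIntegral.integral_add ((by fun_prop : Continuous _).intervalIntegrable _ _)
    ((by fun_prop : Continuous _).intervalIntegrable _ _), intervalIntegral.integral_const_mul,
    intervalIntegral.integral_const_mul, integral_odd_eq_zero
      (g := fun s => f s * Real.sin (n * s)) fun s => by rw [f.even, mul_neg, Real.sin_neg]; ring,
    cosCoeff, torusMean]
  ring

/-- Convolution on the torus with a cosine series. -/
noncomputable def cosConv (a : ℕ → ℝ) (f : ℝ → ℝ) (x : ℝ) : ℝ :=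
  torusMean fun t => cosSeries a t * f (x - t)

/-- The convolution form yields the norm bounds and translation invariance, the series form the
algebra of symbols. -/
theorem cosConv_eq_cosSeries {a : ℕ → ℝ} (ha : Summable fun n => |a n|) (f : HolderZeroEven α) :
    cosConv a f = cosSeries fun n => a n * cosCoeff f n := by
  ext x
  have hc := f.continuous
  rw [cosConv, torusMean_cosSeries_mul ha (by fun_prop), cosSeries]
  simp only [torusMean_translate, mul_assoc]

theorem abs_cosConv_le {a : ℕ → ℝ} (ha : Summable fun n => |a n|) {f : ℝ → ℝ} {A : ℝ}
    (hf : ∀ x, |f x| ≤ A) (x : ℝ) : |cosConv a f x| ≤ (∑' n, |a n|) * A :=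
  abs_torusMean_le fun t => by
    rw [abs_mul]
    exact mul_le_mul (abs_cosSeries_le ha t) (hf _) (abs_nonneg _)
      ((abs_nonneg _).trans (abs_cosSeries_le ha t))

theorem cosConv_sub {a : ℕ → ℝ} (ha : Summable fun n => |a n|) {f g : ℝ → ℝ}
    (hf : Continuous f) (hg : Continuous g) (x : ℝ) :
    cosConv a (fun y => f y - g y) x = cosConv a f x - cosConv a g x := by
  have hc := continuous_cosSeries ha
  simp only [cosConv, torusMean]
  rw [← mul_sub, ← intervalIntegral.integral_sub
    ((by fun_prop : Continuous _).intervalIntegrable _ _)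
    ((by fun_prop : Continuous _).intervalIntegrable _ _)]
  simp only [mul_sub]

theorem continuous_deriv (hα : 1 < α) (f : HolderZeroEven α) : Continuous (deriv f) :=
  f.memHolder_deriv.holderWith.continuous (Real.toNNReal_pos.2 (sub_pos.2 hα))

theorem hasDerivAt_cosConv (hα : 1 < α) {a : ℕ → ℝ} (ha : Summable fun n => |a n|)
    (f : HolderZeroEven α) (x : ℝ) : HasDerivAt (cosConv a f) (cosConv a (deriv f) x) x := by
  have hc := continuous_cosSeries ha
  have hf := f.continuous
  have hf' := continuous_deriv hα f
  refine HasDerivAt.const_mul _ (intervalIntegral.hasDerivAt_integral_of_dominated_loc_of_deriv_le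
    (F := fun x t => cosSeries a t * f (x - t)) (F' := fun x t => cosSeries a t * deriv f (x - t))
    (bound := fun _ => (∑' n, |a n|) * ‖f‖)
    univ_mem (Eventually.of_forall fun y => (by fun_prop : Continuous _).aestronglyMeasurable)
    ((by fun_prop : Continuous _).intervalIntegrable _ _)
    (by fun_prop : Continuous _).aestronglyMeasurable
    (Eventually.of_forall fun t _ y _ => ?_) (by simp)
    (Eventually.of_forall fun t _ y _ => ?_)).2
  · rw [norm_mul]
    exact mul_le_mul (abs_cosSeries_le ha t) (f.abs_deriv_le _) (norm_nonneg _)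
      ((abs_nonneg _).trans (abs_cosSeries_le ha t))
  · exact (HasDerivAt.comp_sub_const y t (f.hasDerivAt (y - t))).const_mul _

/-- The difference is the convolution of f' minus a translate of f', whose sup norm the Hölder bound
controls. -/
theorem abs_cosConv_deriv_sub_le (hα : 1 < α) {a : ℕ → ℝ} (ha : Summable fun n => |a n|)
    (f : HolderZeroEven α) (x y : ℝ) :
    |cosConv a (deriv f) x - cosConv a (deriv f) y| ≤
      (∑' n, |a n|) * ‖f‖ * |x - y| ^ ((α - 1).toNNReal : ℝ) := by
  have hf' := continuous_deriv hα f
  have h1 : cosConv a (deriv f) y = cosConv a (fun z => deriv f (z + (y - x))) x := by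
    simp only [cosConv]
    congr 1
    ext t
    congr 2
    ring
  rw [h1, ← cosConv_sub ha hf' (by fun_prop), mul_assoc]
  refine abs_cosConv_le ha (fun z => (f.abs_deriv_sub_le _ _).trans_eq ?_) x
  rw [show z - (z + (y - x)) = x - y by ring]

theorem summable_mul_cosCoeff {a : ℕ → ℝ} (ha : Summable fun n => |a n|) (f : HolderZeroEven α) :
    Summable fun n => |a n * cosCoeff f n| :=
  (ha.mul_right ‖f‖).of_nonneg_of_le (fun _ => abs_nonneg _) fun n => by
    rw [abs_mul]
    exact mul_le_mul_of_nonneg_left (f.abs_cosCoeff_le n) (abs_nonneg _)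

theorem integral_cosSeries {a : ℕ → ℝ} (ha : Summable fun n => |a n|) (h0 : a 0 = 0) :
    (∫ x in (-Real.pi)..Real.pi, cosSeries a x) = 0 := by
  have h := cosCoeff_cosSeries ha h0 0
  simpa [cosCoeff, torusMean, h0, Real.pi_ne_zero] using h

/-- The Fourier multiplier with an absolutely summable even symbol `m` on `C^α_{0,even}`, as a
convolution. -/
noncomputable def multiplier (hα : 1 < α) {m : ℕ → ℝ} (hm : Summable fun n => |m n|)
    (f : HolderZeroEven α) : HolderZeroEven α :=
  have ha : Summable fun n => |2 * m n| := by
    simpa only [abs_mul] using hm.mul_left |2|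
  mk (cosConv (fun n => 2 * m n) f) (cosConv (fun n => 2 * m n) (deriv f))
    ((∑' n, |2 * m n|) * ‖f‖)
    (fun x => by
      simp only [cosConv]
      congr 1
      ext t
      rw [show x + 2 * Real.pi - t = x - t + 2 * Real.pi by ring, f.periodic])
    (hasDerivAt_cosConv hα ha f) (abs_cosConv_deriv_sub_le hα ha f)
    (by
      rw [cosConv_eq_cosSeries ha]
      exact integral_cosSeries (summable_mul_cosCoeff ha f) (by simp [cosCoeff_zero]))
    (by
      rw [cosConv_eq_cosSeries ha]
      exact even_cosSeries _)

theorem summable_symbol {m : ℕ → ℝ} (hm : Summable fun n => |m n|) (f : HolderZeroEven α) :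
    Summable fun n => |2 * m n * cosCoeff f n| :=
  summable_mul_cosCoeff (by simpa only [abs_mul] using hm.mul_left |2|) f

theorem coe_multiplier_eq_cosSeries (hα : 1 < α) {m : ℕ → ℝ} (hm : Summable fun n => |m n|)
    (f : HolderZeroEven α) :
    ⇑(multiplier hα hm f) = cosSeries fun n => 2 * m n * cosCoeff f n :=
  cosConv_eq_cosSeries (by simpa only [abs_mul] using hm.mul_left |2|) f

theorem cosCoeff_multiplier (hα : 1 < α) {m : ℕ → ℝ} (hm : Summable fun n => |m n|)
    (f : HolderZeroEven α) (n : ℕ) :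
    cosCoeff (multiplier hα hm f) n = m n * cosCoeff f n := by
  rw [coe_multiplier_eq_cosSeries, cosCoeff_cosSeries (summable_symbol hm f)
    (by simp [cosCoeff_zero])]
  ring

theorem norm_multiplier_le (hα : 1 < α) {m : ℕ → ℝ} (hm : Summable fun n => |m n|)
    (f : HolderZeroEven α) : ‖multiplier hα hm f‖ ≤ 3 * (∑' n, |2 * m n|) * ‖f‖ := by
  have ha : Summable fun n => |2 * m n| := by
    simpa only [abs_mul] using hm.mul_left |2|
  rw [mul_assoc]
  exact norm_le_of_hasDerivAt (f := multiplier hα hm f) (hasDerivAt_cosConv hα ha f)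
    (abs_cosConv_le ha f.abs_apply_le)
    (abs_cosConv_le ha f.abs_deriv_le) (abs_cosConv_deriv_sub_le hα ha f)

theorem cosCoeff_add (f g : HolderZeroEven α) (n : ℕ) :
    cosCoeff ⇑(f + g) n = cosCoeff f n + cosCoeff g n := by
  have hf := f.continuous
  have hg := g.continuous
  simp only [cosCoeff, coe_add, Pi.add_apply, add_mul]
  exact torusMean_add (by fun_prop) (by fun_prop)

theorem cosCoeff_smul (c : ℝ) (f : HolderZeroEven α) (n : ℕ) :
    cosCoeff ⇑(c • f) n = c * cosCoeff f n := by
  simp only [cosCoeff, coe_smul, Pi.smul_apply, smul_eq_mul, mul_assoc]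
  exact torusMean_const_mul c _

theorem cosSeries_add {a b : ℕ → ℝ} (ha : Summable fun n => |a n|) (hb : Summable fun n => |b n|) :
    cosSeries (fun n => a n + b n) = cosSeries a + cosSeries b := by
  ext x
  simp only [cosSeries, Pi.add_apply, add_mul]
  exact (summable_cosSeries ha x).tsum_add (summable_cosSeries hb x)

theorem cosSeries_smul (c : ℝ) (a : ℕ → ℝ) :
    cosSeries (fun n => c * a n) = c • cosSeries a := by
  ext x
  simp only [cosSeries, Pi.smul_apply, smul_eq_mul, mul_assoc]
  exact tsum_mul_left

/-- The Fourier multiplier as a continuous linear map. -/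
noncomputable def multiplierL (hα : 1 < α) {m : ℕ → ℝ} (hm : Summable fun n => |m n|) :
    HolderZeroEven α →L[ℝ] HolderZeroEven α :=
  LinearMap.mkContinuous (IsLinearMap.mk' (multiplier hα hm)
    ⟨fun f g => ext' (by
      rw [coe_add, coe_multiplier_eq_cosSeries, coe_multiplier_eq_cosSeries,
        coe_multiplier_eq_cosSeries, ← cosSeries_add (summable_symbol hm f) (summable_symbol hm g)]
      simp only [cosCoeff_add, mul_add]),
    fun c f => ext' (by
      rw [coe_smul, coe_multiplier_eq_cosSeries, coe_multiplier_eq_cosSeries, ← cosSeries_smul]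
      simp only [cosCoeff_smul, mul_left_comm])⟩) _ (norm_multiplier_le hα hm)

theorem coe_multiplierL (hα : 1 < α) {m : ℕ → ℝ} (hm : Summable fun n => |m n|)
    (f : HolderZeroEven α) :
    ⇑(multiplierL hα hm f) = cosConv (fun n => 2 * m n) f := rfl

theorem coe_multiplierL_eq_cosSeries (hα : 1 < α) {m : ℕ → ℝ} (hm : Summable fun n => |m n|)
    (f : HolderZeroEven α) :
    ⇑(multiplierL hα hm f) = cosSeries fun n => 2 * m n * cosCoeff f n :=
  coe_multiplier_eq_cosSeries hα hm f

theorem cosCoeff_multiplierL (hα : 1 < α) {m : ℕ → ℝ} (hm : Summable fun n => |m n|)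
    (f : HolderZeroEven α) (n : ℕ) :
    cosCoeff (multiplierL hα hm f) n = m n * cosCoeff f n :=
  cosCoeff_multiplier hα hm f n

/-- Tailored to the resolvent identity, where the product of the two symbols is a combination of the
symbols themselves and no third multiplier is needed. -/
theorem multiplierL_multiplierL (hα : 1 < α) {m₁ m₂ : ℕ → ℝ} (hm₁ : Summable fun n => |m₁ n|)
    (hm₂ : Summable fun n => |m₂ n|) (p q : ℝ) (h : ∀ n, m₁ n * m₂ n = p * m₁ n + q * m₂ n)
    (f : HolderZeroEven α) :
    multiplierL hα hm₁ (multiplierL hα hm₂ f) =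
      p • multiplierL hα hm₁ f + q • multiplierL hα hm₂ f :=
  ext' (by
    rw [coe_add, coe_smul, coe_smul]
    simp only [coe_multiplierL_eq_cosSeries hα _ (multiplierL hα hm₂ f), cosCoeff_multiplierL]
    rw [coe_multiplierL_eq_cosSeries, coe_multiplierL_eq_cosSeries, ← cosSeries_smul,
      ← cosSeries_smul, ← cosSeries_add
        (by simpa only [abs_mul] using (summable_symbol hm₁ f).mul_left |p|)
        (by simpa only [abs_mul] using (summable_symbol hm₂ f).mul_left |q|)]
    congr 1
    ext n
    linear_combination 2 * cosCoeff f n * h n)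

theorem multiplierL_sub (hα : 1 < α) {m₁ m₂ m : ℕ → ℝ} (hm₁ : Summable fun n => |m₁ n|)
    (hm₂ : Summable fun n => |m₂ n|) (hm : Summable fun n => |m n|) (h : ∀ n, m n = m₁ n - m₂ n)
    (f : HolderZeroEven α) :
    multiplierL hα hm f = multiplierL hα hm₁ f - multiplierL hα hm₂ f :=
  eq_sub_of_add_eq (ext' (by
    rw [coe_add, coe_multiplierL_eq_cosSeries, coe_multiplierL_eq_cosSeries,
      coe_multiplierL_eq_cosSeries,
      ← cosSeries_add (summable_symbol hm f) (summable_symbol hm₂ f)]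
    congr 1
    ext n
    rw [h]
    ring))

end HolderZeroEven

/-! ### The concrete equation in abstract form, and the spectral data at cos(kx). -/

namespace HolderZeroEven

variable {α : ℝ}

/-- The sine part vanishes by evenness, so the coefficient is real and depends only on |k|. -/
theorem torusFourierCoeff_ofReal (f : HolderZeroEven α) (k : ℤ) :
    torusFourierCoeff (fun y => (f y : ℂ)) k = (cosCoeff f k.natAbs : ℂ) := by
  have hc := f.continuous
  have h1 : ∀ y : ℝ, (f y : ℂ) * Complex.exp (-(Complex.I * k * y)) =
      ((f y * Real.cos (k * y) : ℝ) : ℂ) - Complex.I * ((f y * Real.sin (k * y) : ℝ) : ℂ) := by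
    intro y
    rw [show -(Complex.I * k * y) = ((-(k * y) : ℝ) : ℂ) * Complex.I by push_cast; ring,
      Complex.exp_mul_I, ← Complex.ofReal_cos, ← Complex.ofReal_sin, Real.cos_neg, Real.sin_neg]
    push_cast
    ring
  have h2 : (∫ y in (-Real.pi)..Real.pi, f y * Real.sin (k * y)) = 0 :=
    integral_odd_eq_zero fun s => by rw [f.even, mul_neg, Real.sin_neg]; ring
  have h3 : ∀ y : ℝ, Real.cos (k * y) = Real.cos (k.natAbs * y) := fun y => by
    rw [Nat.cast_natAbs, Int.cast_abs]
    rcases abs_choice (k : ℝ) with h | h <;> simp [h]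
  have h4 : ∀ g : ℝ → ℝ, Continuous g →
      IntervalIntegrable (fun y => (g y : ℂ)) MeasureTheory.volume (-Real.pi) Real.pi :=
    fun g hg => (Complex.continuous_ofReal.comp hg).intervalIntegrable _ _
  simp only [torusFourierCoeff, h1]
  rw [intervalIntegral.integral_sub (h4 _ (by fun_prop)) ((h4 _ (by fun_prop)).const_mul _),
    intervalIntegral.integral_const_mul, intervalIntegral.integral_ofReal,
    intervalIntegral.integral_ofReal, h2]
  simp only [h3, cosCoeff, torusMean]
  push_cast
  ring

theorem torusFourierCoeff_sq_zero (f : HolderZeroEven α) :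
    torusFourierCoeff (fun y => (f y : ℂ) ^ 2) 0 = (torusMean fun y => f y * f y : ℝ) := by
  have h1 : ∀ y : ℝ, (f y : ℂ) ^ 2 * Complex.exp (-(Complex.I * (0 : ℤ) * y)) =
      ((f y * f y : ℝ) : ℂ) := by
    intro y
    simp [sq]
  simp only [torusFourierCoeff, h1, torusMean]
  rw [intervalIntegral.integral_ofReal]
  push_cast
  ring

theorem summable_abs_rpow_neg {r : ℝ} (hr : 1 < r) : Summable fun n : ℕ => |(n : ℝ) ^ (-r)| := by
  simpa only [abs_of_nonneg (Real.rpow_nonneg (Nat.cast_nonneg _) (-r))] using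
    Real.summable_nat_rpow.2 (neg_lt_neg hr)

theorem fourierMultiplierL_ofReal {r : ℝ} (hr : 1 < r) (hα : 1 < α) (f : HolderZeroEven α) (x : ℝ) :
    fourierMultiplierL r (fun y => (f y : ℂ)) x =
      (multiplierL hα (summable_abs_rpow_neg hr) f x : ℝ) := by
  set b : ℕ → ℝ := fun n => (n : ℝ) ^ (-r) * cosCoeff f n with hb
  have hbs : Summable fun n => |b n| := summable_mul_cosCoeff (summable_abs_rpow_neg hr) f
  have hterm : ∀ k : ℤ, (if k = 0 then 0 else ((|(k : ℝ)| ^ (-r) : ℝ) : ℂ)) *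
      torusFourierCoeff (fun y => (f y : ℂ)) k * Complex.exp (Complex.I * k * x) =
      (b k.natAbs : ℂ) * Complex.exp (((k * x : ℝ) : ℂ) * Complex.I) := by
    intro k
    rw [torusFourierCoeff_ofReal, show Complex.I * k * x = ((k * x : ℝ) : ℂ) * Complex.I by
      push_cast; ring]
    congr 1
    split_ifs with h
    · simp [hb, h, cosCoeff_zero]
    · rw [hb]
      push_cast
      rw [Nat.cast_natAbs, Int.cast_abs]
  have hs : ∀ y : ℝ, Summable fun n : ℕ => (b n : ℂ) * Complex.exp ((y * n : ℝ) * Complex.I) :=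
    fun y => hbs.of_norm_bounded fun n => by
      rw [norm_mul, Complex.norm_exp_ofReal_mul_I, mul_one, Complex.norm_real, Real.norm_eq_abs]
  have hpos : ∀ n : ℕ, (b (n : ℤ).natAbs : ℂ) * Complex.exp ((((n : ℤ) * x : ℝ) : ℂ) * Complex.I) =
      (b n : ℂ) * Complex.exp ((x * n : ℝ) * Complex.I) := fun n => by
    rw [Int.natAbs_natCast, Int.cast_natCast, mul_comm x]
  have hneg : ∀ n : ℕ, (b (-(n : ℤ)).natAbs : ℂ) *
      Complex.exp ((((-(n : ℤ) : ℤ) * x : ℝ) : ℂ) * Complex.I) =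
      (b n : ℂ) * Complex.exp ((-x * n : ℝ) * Complex.I) := fun n => by
    rw [Int.natAbs_neg, Int.natAbs_natCast, Int.cast_neg, Int.cast_natCast, neg_mul, neg_mul,
      mul_comm x]
  have hb0 : b 0 = 0 := by simp [hb, cosCoeff_zero]
  rw [coe_multiplierL_eq_cosSeries, fourierMultiplierL]
  simp only [hterm]
  -- Splitting ℤ into n ≥ 0 and n ≤ 0 counts the zero mode twice, which is harmless as b 0 = 0.
  -- Pairing n with -n yields the factor 2 of the cosine series.
  rw [Summable.tsum_of_nat_of_neg (by simpa only [hpos] using hs x)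
    (by simpa only [hneg] using hs (-x))]
  simp only [hpos, hneg]
  rw [← (hs x).tsum_add (hs (-x)), cosSeries, Complex.ofReal_tsum, Int.natAbs_zero, hb0,
    Complex.ofReal_zero, zero_mul, sub_zero]
  refine tsum_congr fun n => ?_
  rw [Complex.exp_mul_I, Complex.exp_mul_I, ← Complex.ofReal_cos, ← Complex.ofReal_sin,
    ← Complex.ofReal_cos, ← Complex.ofReal_sin, neg_mul, Real.cos_neg, Real.sin_neg, mul_comm x, hb]
  push_cast
  ring

theorem steadyF_eq_zero_iff {r : ℝ} (hr : 1 < r) (hα₁ : 1 < α) (hα₂ : α ≤ 2)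
    (φ : HolderZeroEven α) (μ : ℝ) :
    steadyF r φ μ = 0 ↔
      μ • φ - multiplierL hα₁ (summable_abs_rpow_neg hr) φ - halfMulL hα₂ φ φ = 0 := by
  have h : ∀ x, steadyF r φ μ x = ((μ • φ - multiplierL hα₁ (summable_abs_rpow_neg hr) φ -
      halfMulL hα₂ φ φ : HolderZeroEven α) x : ℝ) := by
    intro x
    rw [steadyF, fourierMultiplierL_ofReal hr hα₁, torusFourierCoeff_sq_zero, coe_sub, coe_sub,
      Pi.sub_apply, Pi.sub_apply, coe_smul, halfMulL_apply, Pi.smul_apply, smul_eq_mul]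
    push_cast
    ring
  constructor
  · intro h0
    refine ext' (funext fun x => ?_)
    have := congrFun h0 x
    rw [h x] at this
    exact Complex.ofReal_eq_zero.1 this
  · intro h0
    ext x
    rw [h x, h0]
    simp [coe_zero]

/-- The function `cos (k x)` as an element of `C^α_{0,even}`. -/
noncomputable def cosine (hα : α ≤ 2) (k : ℕ) (hk : 1 ≤ k) : HolderZeroEven α :=
  have hβ : ((α - 1).toNNReal : ℝ) ≤ 1 := by
    rw [Real.coe_toNNReal']
    exact max_le (by linarith) zero_le_one
  have hd : ∀ x : ℝ, HasDerivAt (fun x : ℝ => Real.cos (k * x)) (-Real.sin (k * x) * k) x :=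
    fun x => ((hasDerivAt_id x).const_mul (k : ℝ)).cos.congr_deriv (by simp)
  have hd' : ∀ x : ℝ, HasDerivAt (fun x : ℝ => -Real.sin (k * x) * k)
      (-(Real.cos (k * x) * k) * k) x :=
    fun x => (((hasDerivAt_id x).const_mul (k : ℝ)).sin.neg.mul_const _).congr_deriv (by simp)
  have hk' : (1 : ℝ) ≤ k := by exact_mod_cast hk
  -- The derivative is bounded by k ≤ k² and is k²-Lipschitz; interpolation doubles the constant.
  mk (fun x => Real.cos (k * x)) (fun x => -Real.sin (k * x) * k) (2 * (k * k))
    (fun x => by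
      simp only [mul_add]
      exact Real.cos_add_nat_mul_two_pi _ k)
    hd
    (abs_sub_le_rpow_of_bounded_of_lipschitz (NNReal.coe_nonneg _) hβ
      (fun x => by
        rw [abs_mul, abs_neg, Nat.abs_cast]
        exact mul_le_mul ((Real.abs_sin_le_one _).trans hk') le_rfl (by positivity) (by positivity))
      (abs_sub_le_of_hasDerivAt hd' fun x => by
        rw [abs_mul, abs_neg, abs_mul, Nat.abs_cast]
        gcongr
        exact mul_le_of_le_one_left (by positivity) (Real.abs_cos_le_one _)))
    (by
      have h := torusMean_cos_int k
      rw [if_neg (by omega)] at h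
      simpa [torusMean, Real.pi_ne_zero] using h)
    (fun x => by simp only [mul_neg, Real.cos_neg])

theorem cosine_apply (hα : α ≤ 2) {k : ℕ} (hk : 1 ≤ k) (x : ℝ) :
    cosine hα k hk x = Real.cos (k * x) := rfl

theorem cosCoeff_cosine (hα : α ≤ 2) {k : ℕ} (hk : 1 ≤ k) (n : ℕ) :
    cosCoeff (cosine hα k hk) n = if n = k then 1 / 2 else 0 := by
  change torusMean (fun t => Real.cos (k * t) * Real.cos (n * t)) = _
  rw [torusMean_cos_mul_cos, if_neg (by omega : ¬k + n = 0)]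
  simp only [eq_comm (a := k)]
  split_ifs <;> simp

theorem summable_abs_single (k : ℕ) (c : ℝ) : Summable fun n : ℕ => |if n = k then c else 0| :=
  summable_of_ne_finset_zero (s := {k}) fun n hn => by simp [Finset.notMem_singleton.1 hn]

/-- The coordinate of an element of `C^α_{0,even}` along `cos (k x)`. -/
noncomputable def cosCoord (k : ℕ) : HolderZeroEven α →L[ℝ] ℝ :=
  LinearMap.mkContinuous (IsLinearMap.mk' (fun f : HolderZeroEven α => 2 * cosCoeff f k)
    ⟨fun f g => by rw [cosCoeff_add, mul_add], fun c f => by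
      rw [cosCoeff_smul, smul_eq_mul, mul_left_comm]⟩) 2 fun f => by
    change |2 * cosCoeff f k| ≤ _
    rw [abs_mul, abs_two]
    exact mul_le_mul_of_nonneg_left (f.abs_cosCoeff_le k) zero_le_two

theorem cosCoord_apply (k : ℕ) (f : HolderZeroEven α) : cosCoord k f = 2 * cosCoeff f k := rfl

/-- The rank-one term a(·)c of T is itself a multiplier, so T is a scalar minus a multiplier. -/
theorem multiplierL_single (hα₁ : 1 < α) (hα₂ : α ≤ 2) {k : ℕ} (hk : 1 ≤ k)
    (f : HolderZeroEven α) :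
    multiplierL hα₁ (summable_abs_single k 1) f = cosCoord k f • cosine hα₂ k hk := by
  refine ext' (funext fun x => ?_)
  rw [coe_multiplierL_eq_cosSeries, coe_smul, Pi.smul_apply, cosine_apply, cosCoord_apply,
    cosSeries, tsum_eq_single k fun n hn => by simp [hn]]
  simp

theorem multiplierL_cosine (hα₁ : 1 < α) (hα₂ : α ≤ 2) {k : ℕ} (hk : 1 ≤ k) {m : ℕ → ℝ}
    (hm : Summable fun n => |m n|) :
    multiplierL hα₁ hm (cosine hα₂ k hk) = m k • cosine hα₂ k hk := by
  refine ext' (funext fun x => ?_)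
  rw [coe_multiplierL_eq_cosSeries, coe_smul, Pi.smul_apply, cosine_apply,
    cosSeries, tsum_eq_single k fun n hn => by simp [cosCoeff_cosine, hn], cosCoeff_cosine,
    if_pos rfl, smul_eq_mul]
  ring

/-- This symbol is 1/(μ - m) - 1/μ. Since m n → 0, the denominators tend to μ² ≠ 0, and the symbol
is eventually dominated by a multiple of |m n|. -/
theorem summable_resolvent_symbol {m : ℕ → ℝ} (hm : Summable fun n => |m n|) {μ : ℝ} (hμ : μ ≠ 0) :
    Summable fun n => |m n / (μ * (μ - m n))| := by
  have h1 : Tendsto m atTop (𝓝 0) := (tendsto_zero_iff_abs_tendsto_zero _).2 hm.tendsto_atTop_zero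
  have h2 : Tendsto (fun n => |(μ * (μ - m n))⁻¹|) atTop (𝓝 |(μ * (μ - 0))⁻¹|) :=
    ((tendsto_const_nhds.mul (tendsto_const_nhds.sub h1)).inv₀ (by simpa using hμ)).abs
  have h3 := h2.eventually_le_const (lt_add_one _)
  refine (hm.mul_right (|(μ * (μ - 0))⁻¹| + 1)).of_norm_bounded_eventually_nat ?_
  filter_upwards [h3] with n hn
  rw [Real.norm_eq_abs, abs_abs, div_eq_mul_inv, abs_mul]
  exact mul_le_mul_of_nonneg_left hn (abs_nonneg _)

/-- The operator `μ - M`, where `M` is the multiplier with symbol `m`. It is invertible if `μ` is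
nonzero and not a value of `m`; the inverse is again a scalar plus a multiplier. -/
noncomputable def scalarSubMultiplier (hα : 1 < α) {m : ℕ → ℝ} (hm : Summable fun n => |m n|)
    {μ : ℝ} (hμ : μ ≠ 0) (hne : ∀ n, m n ≠ μ) : HolderZeroEven α ≃L[ℝ] HolderZeroEven α :=
  -- With ρ for the resolvent symbol, this is (1/μ + ρ)(μ - m) = 1 expanded.
  have h1 : ∀ n, m n / (μ * (μ - m n)) * m n = μ * (m n / (μ * (μ - m n))) + -μ⁻¹ * m n :=
    fun n => by
      have := sub_ne_zero.2 (hne n).symm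
      field_simp
      ring
  ContinuousLinearEquiv.equivOfInverse
    (μ • ContinuousLinearMap.id ℝ _ - multiplierL hα hm)
    (μ⁻¹ • ContinuousLinearMap.id ℝ _ + multiplierL hα (summable_resolvent_symbol hm hμ))
    (fun f => by
      have h2 := multiplierL_multiplierL hα (summable_resolvent_symbol hm hμ) hm μ (-μ⁻¹) h1 f
      simp only [add_apply, sub_apply, smul_apply, ContinuousLinearMap.id_apply, map_sub, map_smul,
        h2]
      match_scalars <;> field_simp <;> ring)
    (fun f => by
      have h2 := multiplierL_multiplierL hα hm (summable_resolvent_symbol hm hμ) (-μ⁻¹) μ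
        (fun n => by rw [mul_comm, h1, add_comm]) f
      simp only [add_apply, sub_apply, smul_apply, ContinuousLinearMap.id_apply, map_add, map_smul,
        h2]
      match_scalars <;> field_simp <;> ring)

/-- The elements of `C^α_{0,even}` with period `p`. -/
def periodicSubmodule (α p : ℝ) : Submodule ℝ (HolderZeroEven α) where
  carrier := {f | Function.Periodic f p}
  zero_mem' := fun _ => rfl
  add_mem' := fun hf hg => hf.add hg
  smul_mem' := fun c _ hf => hf.smul c

theorem mem_periodicSubmodule {p : ℝ} {f : HolderZeroEven α} :
    f ∈ periodicSubmodule α p ↔ Function.Periodic f p := Iff.rfl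

theorem isClosed_periodicSubmodule (p : ℝ) :
    IsClosed (periodicSubmodule α p : Set (HolderZeroEven α)) := by
  have : (periodicSubmodule α p : Set (HolderZeroEven α)) = ⋂ x, {f | eval (x + p) f = eval x f} := by
    ext f
    simp only [Set.mem_iInter]
    exact Iff.rfl
  rw [this]
  exact isClosed_iInter fun x => isClosed_eq (eval _).continuous (eval _).continuous

theorem multiplierL_mem_periodicSubmodule (hα : 1 < α) {m : ℕ → ℝ} (hm : Summable fun n => |m n|)
    {p : ℝ} {f : HolderZeroEven α} (hf : f ∈ periodicSubmodule α p) :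
    multiplierL hα hm f ∈ periodicSubmodule α p := fun x => by
  rw [coe_multiplierL]
  simp only [cosConv]
  congr 1
  ext t
  rw [add_sub_right_comm, mem_periodicSubmodule.1 hf]

theorem halfMulL_mem_periodicSubmodule (hα : α ≤ 2) {p : ℝ} {f g : HolderZeroEven α}
    (hf : f ∈ periodicSubmodule α p) (hg : g ∈ periodicSubmodule α p) :
    halfMulL hα f g ∈ periodicSubmodule α p := fun x => by
  rw [halfMulL_apply, halfMulL_apply, mem_periodicSubmodule.1 hf, mem_periodicSubmodule.1 hg]

end HolderZeroEven

/-! ### Assembly of the bifurcation theorem. -/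

open HolderZeroEven in
theorem theorem5p1 (r α : ℝ) (hr : 1 < r) (hα₁ : 1 < α) (hα₂ : α < 2) (k : ℕ) (hk : 1 ≤ k) :
    IsBifurcationPoint (fun (φ : HolderZeroEven α) (μ : ℝ) => steadyF r φ μ) ((k : ℝ) ^ (-r)) ∧
    ∃ ε₀ : ℝ, 0 < ε₀ ∧ ∃ (φ : ℝ → HolderZeroEven α) (μ : ℝ → ℝ),
      AnalyticOnNhd ℝ (fun ε => (φ ε, μ ε)) (Set.Ioo (-ε₀) ε₀) ∧
      φ 0 = 0 ∧ μ 0 = (k : ℝ) ^ (-r) ∧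
      (∀ x : ℝ, deriv φ 0 x = Real.cos (k * x)) ∧
      (∀ ε : ℝ, |ε| < ε₀ →
        0 < μ ε ∧ steadyF r (φ ε) (μ ε) = 0 ∧ (ε ≠ 0 → φ ε ≠ 0) ∧
        Function.Periodic (φ ε) (2 * Real.pi / k)) ∧
      (∀ᶠ p : HolderZeroEven α × ℝ in 𝓝 (0, (k : ℝ) ^ (-r)),
        steadyF r p.1 p.2 = 0 → p.1 ≠ 0 → ∃ ε : ℝ, |ε| < ε₀ ∧ p = (φ ε, μ ε)) := by
  have hk0 : (0 : ℝ) < k := by exact_mod_cast hk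
  set μ₀ : ℝ := (k : ℝ) ^ (-r) with hμ₀
  have hμpos : 0 < μ₀ := Real.rpow_pos_of_pos hk0 _
  have hm : Summable fun n : ℕ => |(n : ℝ) ^ (-r) - if n = k then 1 else 0| :=
    ((summable_abs_rpow_neg hr).add (summable_abs_single k 1)).of_nonneg_of_le
      (fun _ => abs_nonneg _) fun n => abs_sub _ _
  -- At n = k the symbol is μ₀ - 1. Elsewhere n ↦ n^{-r} is injective, including n = 0, where the
  -- value of the real power is 0.
  have hne : ∀ n : ℕ, (n : ℝ) ^ (-r) - (if n = k then 1 else 0) ≠ μ₀ := fun n => by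
    split_ifs with h
    · rw [h]
      linarith
    · rw [sub_zero, hμ₀, Ne, Real.rpow_left_inj (by positivity) hk0.le (by linarith)]
      exact_mod_cast h
  obtain ⟨φ, μ, hφ, hμ, hφ0, hμ0, hφ', hcoord, hmem, hsol, huniq⟩ :=
    exists_analytic_branch_mem (L := multiplierL hα₁ (summable_abs_rpow_neg hr))
      (a := cosCoord k) (c := cosine hα₂.le k hk) (μ₀ := μ₀) (halfMulL hα₂.le)
      (scalarSubMultiplier hα₁ hm hμpos.ne' hne)
      (fun f => by
        change μ₀ • f - multiplierL hα₁ hm f = _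
        rw [multiplierL_sub hα₁ (summable_abs_rpow_neg hr) (summable_abs_single k 1) hm
          (fun _ => rfl), multiplierL_single hα₁ hα₂.le hk]
        abel)
      (multiplierL_cosine hα₁ hα₂.le hk _)
      (by simp [cosCoord_apply, cosCoeff_cosine])
      (fun f => by
        rw [cosCoord_apply, cosCoord_apply, cosCoeff_multiplierL]
        ring)
      (periodicSubmodule α (2 * Real.pi / k)) (isClosed_periodicSubmodule _)
      (fun x => by
        rw [cosine_apply, cosine_apply, mul_add, mul_div_cancel₀ _ hk0.ne', Real.cos_add_two_pi])
      (fun f hf => multiplierL_mem_periodicSubmodule hα₁ _ hf)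
      (fun f hf => Submodule.add_mem _ (Submodule.smul_mem _ _ hf)
        (multiplierL_mem_periodicSubmodule hα₁ _ hf))
      (fun f hf g hg => halfMulL_mem_periodicSubmodule hα₂.le hf hg)
  simp only [← steadyF_eq_zero_iff hr hα₁ hα₂.le] at hsol huniq
  have hφne : ∀ ε, ε ≠ 0 → φ ε ≠ 0 := fun ε hε h => hε (by rw [← hcoord ε, h, map_zero])
  refine ⟨⟨fun ν => (steadyF_eq_zero_iff hr hα₁ hα₂.le 0 ν).2 (by simp), ?_⟩, ?_⟩
  · have ht : Tendsto (fun ε => (φ ε, μ ε)) (𝓝[≠] 0) (𝓝 (0, μ₀)) := by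
      have h := (hφ.continuousAt.prodMk hμ.continuousAt).tendsto
      rw [hφ0, hμ0] at h
      exact h.mono_left nhdsWithin_le_nhds
    refine ht.frequently (Eventually.frequently ?_)
    filter_upwards [hsol.filter_mono nhdsWithin_le_nhds, self_mem_nhdsWithin] with ε h1 h2
    exact ⟨h1, hφne ε h2⟩
  have hμev : ∀ᶠ ε in 𝓝 (0 : ℝ), 0 < μ ε :=
    hμ.continuousAt.eventually_const_lt (by rwa [hμ0])
  obtain ⟨ε₀, hε₀, hball⟩ := Metric.eventually_nhds_iff.1
    ((hφ.prod hμ).eventually_analyticAt.and (hμev.and (hsol.and hmem)))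
  simp only [Real.dist_eq, sub_zero] at hball
  refine ⟨ε₀, hε₀, φ, μ, fun ε hε => (hball (abs_lt.2 hε)).1, hφ0, hμ0, fun x => ?_,
    fun ε hε => ?_, ?_⟩
  · rw [hφ'.deriv, cosine_apply]
  · obtain ⟨-, h1, h2, h3⟩ := hball hε
    exact ⟨h1, h2, hφne ε, h3⟩
  · have hc : ∀ᶠ p : HolderZeroEven α × ℝ in 𝓝 (0, μ₀), |cosCoord k p.1| < ε₀ :=
      (by fun_prop : Continuous fun p : HolderZeroEven α × ℝ =>
        |cosCoord k p.1|).continuousAt.eventually_lt_const (by simpa using hε₀)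
    filter_upwards [huniq, hc] with p h1 h2 h3 h4
    exact ⟨_, h2, h1 h3 h4⟩
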